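/- A matchstick graph is a finite simple graph drawn in the Euclidean plane so that its vertices are distinct points, its edges are straight-line segments of length $1$ joining their end-vertices, and any two distinct edges intersect only at common endpoints; isolated vertices are allowed. In any matchstick graph on $n \ge 1$ vertices, the number of vertices of degree at most $4$ is greater than $\frac14\sqrt{\pi\sqrt3\cdot n}$. This bound is sharp up to the constant: there is a constant $C>0$ such that for every $n$ there is a matchstick graph on $n$ vertices with at most $C\sqrt n$ vertices of degree at most $4$. -/

import Mathlib

/-- `IsMatchstickDrawing G p`: placing the vertices of `G` at the points `p v` and drawing every
edge as a straight-line segment gives a plane drawing of `G` all of whose edges have length `1`.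
Two different edges may meet only in a common endpoint. -/
structure IsMatchstickDrawing {V : Type*} (G : SimpleGraph V)
    (p : V → EuclideanSpace ℝ (Fin 2)) : Prop where
  /-- The vertices are distinct points. -/
  injective : Function.Injective p
  /-- Every edge has unit length. -/
  unit_length : ∀ u v : V, G.Adj u v → dist (p u) (p v) = 1
  /-- Different edges intersect only at (necessarily common) endpoints. -/
  crossing_free : ∀ u v x y : V, G.Adj u v → G.Adj x y → s(u, v) ≠ s(x, y) →
    segment ℝ (p u) (p v) ∩ segment ℝ (p x) (p y) ⊆ p '' (({u, v} : Set V) ∩ {x, y})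

/-- A graph is a matchstick graph if it has a matchstick drawing in the Euclidean plane. -/
def IsMatchstickGraph {V : Type*} (G : SimpleGraph V) : Prop :=
  ∃ p : V → EuclideanSpace ℝ (Fin 2), IsMatchstickDrawing G p

/-
Discard the isolated vertices and extend the remaining graph to a maximal plane straight-line graph.
Edges that are consecutive around a vertex and span an angle less than `π` are then sides of a
triangle. Merging these triangles across the edges that were added gives the faces of the
matchstick graph. Let `n` be the number of its vertices, `m` the number of those of degree at most
`4`, `e` the number of edges, `k` the length of the outer boundary and `s` the number of faces that
are equilateral triangles.

Measure angles in units of `π / 3` and charge to a corner of angle `y` the signed distance from `y`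
to the interval `[1, 2]`. An inner face then receives a nonnegative total charge, the outer face at
least `k`, and a vertex at most `4`, and at most `0` if its degree is at least `5`. Hence `k ≤ 4 m`.
Summing the angles themselves face by face gives `2 e + k ≤ 4 n + s`, where `2 e ≥ 5 n - 4 m`. The
triangles are enclosed by the outer boundary, so the isoperimetric inequality, which for equilateral
polygons follows from the discrete Fourier transform, bounds `s √3 / 4` by `k² / (4 π)`. The bound
on `m` follows from these inequalities. It is sharp up to the constant for `n` points of the
triangular lattice in rows of length about `√n`.
-/

attribute [local instance] Complex.finrank_real_complex_fact

local notation "ω" => Orientation.areaForm Complex.orientation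

lemma areaForm_apply (a b : ℂ) : ω a b = a.re * b.im - a.im * b.re := by
  rw [Complex.areaForm, Complex.mul_im, Complex.conj_re, Complex.conj_im]
  ring

section DiscreteFourier

open ZMod ComplexConjugate

variable {N : ℕ} [NeZero N]

lemma sum_conj_dft_mul_dft (f g : ZMod N → ℂ) :
    ∑ h, conj (dft f h) * dft g h = N * ∑ j, conj (f j) * g j := by
  have conj_dft (h : ZMod N) : conj (dft f h) = ∑ j, conj (f j) * stdAddChar (h * j) := by
    simp only [dft_apply, map_sum, smul_eq_mul, map_mul, AddChar.map_neg_eq_conj,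
      Complex.conj_conj, mul_comm]
  have inversion (j : ZMod N) : ∑ h, stdAddChar (h * j) * dft g h = N * g j := by
    simpa only [dft_apply (dft g), mul_neg, neg_neg, smul_eq_mul] using congrFun (dft_dft g) (-j)
  simp only [conj_dft, Finset.sum_mul, Finset.mul_sum]
  rw [Finset.sum_comm]
  refine Finset.sum_congr rfl fun j _ => ?_
  rw [mul_left_comm, ← inversion, Finset.mul_sum]
  simp only [mul_assoc]

lemma dft_comp_add_one (f : ZMod N → ℂ) (h : ZMod N) :
    dft (fun j => f (j + 1)) h = stdAddChar h * dft f h := by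
  rw [dft_apply, dft_apply, Finset.mul_sum, ← Equiv.sum_comp (Equiv.subRight (1 : ZMod N))]
  refine Finset.sum_congr rfl fun j _ => ?_
  simp only [Equiv.subRight_apply, sub_add_cancel, smul_eq_mul]
  rw [← mul_assoc, ← AddChar.map_add_eq_mul]
  congr 2
  ring

lemma card_mul_sum_areaForm_add_one (f : ZMod N → ℂ) :
    N * ∑ j, ω (f j) (f (j + 1)) = ∑ h : ZMod N, (stdAddChar h : ℂ).im * ‖dft f h‖ ^ 2 := by
  have spectral (h : ZMod N) : conj (dft f h) * dft (fun j => f (j + 1)) h =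
      stdAddChar h * ((‖dft f h‖ ^ 2 : ℝ) : ℂ) := by
    rw [dft_comp_add_one, Complex.ofReal_pow, ← Complex.conj_mul']
    ring
  have parseval := congrArg Complex.im (sum_conj_dft_mul_dft f fun j => f (j + 1))
  simp only [spectral, ← Complex.ofReal_natCast, Complex.im_ofReal_mul, Complex.im_sum,
    Complex.im_mul_ofReal] at parseval
  simpa only [Complex.areaForm] using parseval.symm

lemma card_mul_sum_norm_sub_sq (f : ZMod N → ℂ) :
    N * ∑ j, ‖f (j + 1) - f j‖ ^ 2 =
      ∑ h : ZMod N, ‖(stdAddChar h : ℂ) - 1‖ ^ 2 * ‖dft f h‖ ^ 2 := by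
  have dft_sub (h : ZMod N) :
      dft (fun j => f (j + 1) - f j) h = (stdAddChar h - 1) * dft f h := by
    change dft ((fun j => f (j + 1)) - f) h = _
    rw [map_sub, Pi.sub_apply, dft_comp_add_one]
    ring
  have parseval := sum_conj_dft_mul_dft (fun j => f (j + 1) - f j) fun j => f (j + 1) - f j
  simp only [dft_sub, Complex.conj_mul', norm_mul] at parseval
  simp only [← mul_pow]
  exact_mod_cast parseval.symm

lemma stdAddChar_eq_exp (h : ZMod N) :
    (stdAddChar h : ℂ) = Complex.exp ((2 * (Real.pi * h.val / N) : ℝ) * Complex.I) := by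
  have := stdAddChar_coe (N := N) (h.val : ℤ)
  rw [Int.cast_natCast, natCast_zmod_val] at this
  rw [this]
  push_cast
  congr 1
  ring

lemma sin_mul_im_stdAddChar_le (h : ZMod N) {M : ℕ} (hM : N ≤ M) :
    Real.sin (Real.pi / M) * (stdAddChar h : ℂ).im ≤
      Real.cos (Real.pi / M) / 2 * ‖(stdAddChar h : ℂ) - 1‖ ^ 2 := by
  have hN : (0 : ℝ) < N := by exact_mod_cast Nat.pos_of_ne_zero (NeZero.ne N)
  set θ := Real.pi * h.val / N with hθ
  set η := Real.pi / M with hη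
  have hη0 : 0 ≤ η := by positivity
  have hθ0 : 0 ≤ θ := by positivity
  have hθπ : θ ≤ Real.pi := by
    rw [hθ, div_le_iff₀ hN]
    gcongr
    exact h.val_lt.le
  have key : 0 ≤ Real.sin θ * Real.sin (θ - η) := by
    rcases Nat.eq_zero_or_pos h.val with h0 | h0
    · simp [hθ, h0]
    · have hηθ : η ≤ θ := by
        have : (1 : ℝ) ≤ h.val := by exact_mod_cast h0
        rw [hη, hθ]
        gcongr
        exact le_mul_of_one_le_right Real.pi_pos.le this
      exact mul_nonneg (Real.sin_nonneg_of_nonneg_of_le_pi hθ0 hθπ)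
        (Real.sin_nonneg_of_nonneg_of_le_pi (sub_nonneg.2 hηθ) (by linarith))
  rw [stdAddChar_eq_exp, mul_comm _ Complex.I, Complex.norm_exp_I_mul_ofReal_sub_one,
    mul_div_cancel_left₀ _ two_ne_zero, Real.norm_eq_abs, sq_abs, mul_comm Complex.I,
    Complex.exp_ofReal_mul_I_im, Real.sin_two_mul]
  rw [Real.sin_sub] at key
  linarith

lemma sin_mul_sum_areaForm_le (f : ZMod N → ℂ) {M : ℕ} (hM : N ≤ M) :
    Real.sin (Real.pi / M) * ∑ j, ω (f j) (f (j + 1)) ≤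
      Real.cos (Real.pi / M) / 2 * ∑ j, ‖f (j + 1) - f j‖ ^ 2 := by
  have hN : (0 : ℝ) < N := by exact_mod_cast Nat.pos_of_ne_zero (NeZero.ne N)
  refine le_of_mul_le_mul_left ?_ hN
  rw [mul_left_comm, mul_left_comm (N : ℝ), card_mul_sum_areaForm_add_one,
    card_mul_sum_norm_sub_sq, Finset.mul_sum, Finset.mul_sum]
  refine Finset.sum_le_sum fun h _ => ?_
  rw [← mul_assoc, ← mul_assoc]
  exact mul_le_mul_of_nonneg_right (sin_mul_im_stdAddChar_le h hM) (by positivity)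

end DiscreteFourier

section Permutation

variable {S : Type*} [Fintype S]

lemma sum_range_mul_of_periodic {R : Type*} [Semiring R] {a : ℕ → R} {c : ℕ}
    (ha : Function.Periodic a c) (q : ℕ) :
    ∑ j ∈ Finset.range (c * q), a j = q * ∑ j ∈ Finset.range c, a j := by
  induction q with
  | zero => simp only [mul_zero, Finset.range_zero, Finset.sum_empty, Nat.cast_zero, zero_mul]
  | succ q ih =>
    have shift (j : ℕ) : a (c * q + j) = a j := by
      simpa only [add_comm, mul_comm, Nat.cast_id] using ha.nat_mul q j
    rw [Nat.mul_succ, Finset.sum_range_add, ih, Nat.cast_succ, add_one_mul]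
    simp only [shift]

lemma sum_nonpos_of_sum_orbit_nonpos (σ : Equiv.Perm S) (F : S → ℝ)
    (hF : ∀ s, ∑ j ∈ Finset.range (Function.minimalPeriod σ s), F ((σ ^ j) s) ≤ 0) :
    ∑ s, F s ≤ 0 := by
  have sum_orderOf_nonpos (s : S) : ∑ j ∈ Finset.range (orderOf σ), F ((σ ^ j) s) ≤ 0 := by
    have periodic : Function.Periodic (fun j => F ((σ ^ j) s)) (Function.minimalPeriod σ s) := by
      intro j
      have := Function.iterate_minimalPeriod (f := σ) (x := s)
      rw [Equiv.Perm.iterate_eq_pow] at this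
      simp only [pow_add, Equiv.Perm.mul_apply, this]
    obtain ⟨q, hq⟩ : Function.minimalPeriod σ s ∣ orderOf σ := by
      refine Function.IsPeriodicPt.minimalPeriod_dvd ?_
      rw [Function.IsPeriodicPt, Function.IsFixedPt, Equiv.Perm.iterate_eq_pow, pow_orderOf_eq_one,
        Equiv.Perm.one_apply]
    rw [hq, sum_range_mul_of_periodic periodic]
    exact mul_nonpos_of_nonneg_of_nonpos q.cast_nonneg (hF s)
  have average : ∑ s, ∑ j ∈ Finset.range (orderOf σ), F ((σ ^ j) s) = orderOf σ * ∑ s, F s := by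
    rw [Finset.sum_comm]
    simp only [Equiv.sum_comp, Finset.sum_const, Finset.card_range, nsmul_eq_mul]
  have hpos : (0 : ℝ) < orderOf σ := by exact_mod_cast orderOf_pos σ
  refine nonpos_of_mul_nonpos_right ?_ hpos
  exact average ▸ Finset.sum_nonpos fun s _ => sum_orderOf_nonpos s

lemma sum_zmod_eq_sum_range {M : Type*} [AddCommMonoid M] (c : ℕ) [NeZero c] (a : ℕ → M) :
    ∑ j : ZMod c, a j.val = ∑ j ∈ Finset.range c, a j :=
  Finset.sum_nbij' ZMod.val (fun j => (j : ZMod c)) (by simp [ZMod.val_lt]) (by simp)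
    (by simp) (fun j hj => ZMod.val_cast_of_lt (Finset.mem_range.1 hj)) (by simp)

/-- Summing the polygon inequality over the cycles of `σ`. -/
lemma sin_mul_sum_areaForm_perm_le (σ : Equiv.Perm S) (w : S → ℂ) :
    Real.sin (Real.pi / Fintype.card S) * ∑ s, ω (w s) (w (σ s)) ≤
      Real.cos (Real.pi / Fintype.card S) / 2 * ∑ s, ‖w (σ s) - w s‖ ^ 2 := by
  rw [← sub_nonpos, Finset.mul_sum, Finset.mul_sum, ← Finset.sum_sub_distrib]
  refine sum_nonpos_of_sum_orbit_nonpos σ _ fun s => ?_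
  set c := Function.minimalPeriod σ s
  have hc0 : 0 < c :=
    Function.minimalPeriod_pos_of_mem_periodicPts (σ.injective.mem_periodicPts s)
  have : NeZero c := ⟨hc0.ne'⟩
  have hsucc (j : ZMod c) : (σ ^ (j + 1).val) s = σ ((σ ^ j.val) s) := by
    rw [← Equiv.Perm.mul_apply, ← pow_succ', ZMod.val_add, ZMod.val_one_eq_one_mod,
      Nat.add_mod_mod, ← Equiv.Perm.iterate_eq_pow, ← Equiv.Perm.iterate_eq_pow]
    exact Function.iterate_mod_minimalPeriod_eq
  have polygon := sin_mul_sum_areaForm_le (fun j : ZMod c => w ((σ ^ j.val) s))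
    (Function.minimalPeriod_le_card (f := σ) (x := s))
  simp only [hsucc] at polygon
  rw [Finset.sum_sub_distrib, ← Finset.mul_sum, ← Finset.mul_sum, sub_nonpos]
  rwa [sum_zmod_eq_sum_range c fun j => ω (w ((σ ^ j) s)) (w (σ ((σ ^ j) s))),
    sum_zmod_eq_sum_range c fun j => ‖w (σ ((σ ^ j) s)) - w ((σ ^ j) s)‖ ^ 2] at polygon

lemma sum_areaForm_perm_lt [Nonempty S] (σ : Equiv.Perm S) (w : S → ℂ)
    (hw : ∀ s, ‖w (σ s) - w s‖ = 1) :
    ∑ s, ω (w s) (w (σ s)) < (Fintype.card S : ℝ) ^ 2 / (2 * Real.pi) := by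
  have isoperimetric := sin_mul_sum_areaForm_perm_le σ w
  simp only [hw, one_pow, Finset.sum_const, Finset.card_univ, nsmul_eq_mul, mul_one]
    at isoperimetric
  have σ_ne (t : S) : σ t ≠ t := fun ht => by
    simpa only [ht, sub_self, norm_zero, zero_ne_one] using hw t
  have : Nontrivial S := ⟨⟨_, _, σ_ne (Classical.arbitrary S)⟩⟩
  have two_le_card : 2 ≤ Fintype.card S := Fintype.one_lt_card
  set n := Fintype.card S
  have hπ := Real.pi_pos
  rcases two_le_card.eq_or_lt with n_eq_two | three_le_card
  · rw [← n_eq_two] at isoperimetric ⊢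
    simp only [Nat.cast_ofNat, Real.sin_pi_div_two, Real.cos_pi_div_two, one_mul, zero_div,
      zero_mul] at isoperimetric
    exact isoperimetric.trans_lt (by positivity)
  · have three_le : (3 : ℝ) ≤ n := by exact_mod_cast three_le_card
    set η := Real.pi / n with hη
    have π_eq : Real.pi = η * n := by rw [hη]; field_simp
    have η_pos : 0 < η := by positivity
    have η_lt : η < Real.pi / 2 := by
      rw [hη]
      gcongr
      linarith
    have cos_pos : 0 < Real.cos η := Real.cos_pos_of_mem_Ioo ⟨by linarith, η_lt⟩
    have sin_pos : 0 < Real.sin η := Real.sin_pos_of_pos_of_lt_pi η_pos (by linarith)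
    have η_mul_cos_lt : η * Real.cos η < Real.sin η := by
      rw [← lt_div_iff₀ cos_pos, ← Real.tan_eq_sin_div_cos]
      exact Real.lt_tan η_pos η_lt
    rw [lt_div_iff₀ (by positivity)]
    refine lt_of_mul_lt_mul_left ?_ sin_pos.le
    calc Real.sin η * ((∑ s, ω (w s) (w (σ s))) * (2 * Real.pi))
        ≤ Real.cos η / 2 * n * (2 * Real.pi) := by
          rw [← mul_assoc]
          exact mul_le_mul_of_nonneg_right isoperimetric (by positivity)
      _ = η * Real.cos η * (n * n) := by rw [π_eq]; ring
      _ < Real.sin η * (n * n) := by gcongr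
      _ = Real.sin η * n ^ 2 := by ring

end Permutation

/-- The counterclockwise angle from `a` to `b`, normalised to lie in `(0, 2π]`, so that it is `2π`
rather than `0` when `a` and `b` have the same direction. -/
noncomputable def ccwAngle (a b : ℂ) : ℝ :=
  toIocMod Real.two_pi_pos 0 (Complex.arg b - Complex.arg a)

section CcwAngle

variable {a b c : ℂ}

lemma ccwAngle_pos : 0 < ccwAngle a b := (toIocMod_mem_Ioc Real.two_pi_pos 0 _).1

lemma ccwAngle_le : ccwAngle a b ≤ 2 * Real.pi :=
  (toIocMod_mem_Ioc Real.two_pi_pos 0 _).2.trans (zero_add _).le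

lemma coe_ccwAngle (a b : ℂ) :
    (ccwAngle a b : Real.Angle) = Complex.arg b - Complex.arg a := by
  rw [ccwAngle, Real.Angle.coe_toIocMod, Real.Angle.coe_sub]

lemma eq_ccwAngle_of_coe_eq {θ : ℝ} (pos : 0 < θ) (le : θ ≤ 2 * Real.pi)
    (h : (θ : Real.Angle) = Complex.arg b - Complex.arg a) : θ = ccwAngle a b := by
  have mem : θ ∈ Set.Ioc 0 (0 + 2 * Real.pi) := ⟨pos, by rwa [zero_add]⟩
  rw [← Real.Angle.coe_sub, Real.Angle.angle_eq_iff_two_pi_dvd_sub] at h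
  obtain ⟨k, hk⟩ := h
  rw [ccwAngle, ← (toIocMod_eq_self Real.two_pi_pos).2 mem, sub_eq_iff_eq_add'.1 hk,
    mul_comm _ (k : ℝ), ← zsmul_eq_mul, toIocMod_add_zsmul]

lemma ccwAngle_of_arg_lt (h : Complex.arg a < Complex.arg b) :
    ccwAngle a b = Complex.arg b - Complex.arg a :=
  (eq_ccwAngle_of_coe_eq (sub_pos.2 h)
    (by linarith [Complex.arg_le_pi b, Complex.neg_pi_lt_arg a]) (Real.Angle.coe_sub _ _)).symm

lemma ccwAngle_of_arg_le (h : Complex.arg b ≤ Complex.arg a) :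
    ccwAngle a b = Complex.arg b - Complex.arg a + 2 * Real.pi :=
  (eq_ccwAngle_of_coe_eq (by linarith [Complex.arg_le_pi a, Complex.neg_pi_lt_arg b])
    (by linarith) (by rw [Real.Angle.coe_add, Real.Angle.coe_two_pi, add_zero,
      Real.Angle.coe_sub])).symm

lemma ccwAngle_add (h : ccwAngle a b + ccwAngle b c ≤ 2 * Real.pi) :
    ccwAngle a b + ccwAngle b c = ccwAngle a c :=
  eq_ccwAngle_of_coe_eq (add_pos ccwAngle_pos ccwAngle_pos) h <| by
    rw [Real.Angle.coe_add, coe_ccwAngle, coe_ccwAngle]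
    abel

lemma arg_eq_of_ccwAngle_eq (h : ccwAngle a b = ccwAngle a c) :
    Complex.arg b = Complex.arg c := by
  have coe_eq := congr_arg ((↑) : ℝ → Real.Angle) h
  rwa [coe_ccwAngle, coe_ccwAngle, sub_left_inj, Complex.arg_coe_angle_eq_iff] at coe_eq

lemma norm_mul_sin_ccwAngle (a b : ℂ) :
    ‖a‖ * ‖b‖ * Real.sin (ccwAngle a b) = ω a b := by
  rw [← Real.Angle.sin_coe, coe_ccwAngle, ← Real.Angle.coe_sub, Real.Angle.sin_coe, Real.sin_sub,
    areaForm_apply, ← Complex.norm_mul_cos_arg a, ← Complex.norm_mul_sin_arg a,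
    ← Complex.norm_mul_cos_arg b, ← Complex.norm_mul_sin_arg b]
  ring

lemma norm_mul_cos_ccwAngle (a b : ℂ) :
    ‖a‖ * ‖b‖ * Real.cos (ccwAngle a b) = inner ℝ a b := by
  rw [← Real.Angle.cos_coe, coe_ccwAngle, ← Real.Angle.coe_sub, Real.Angle.cos_coe, Real.cos_sub,
    Complex.inner, Complex.mul_re, Complex.conj_re, Complex.conj_im,
    ← Complex.norm_mul_cos_arg a, ← Complex.norm_mul_sin_arg a,
    ← Complex.norm_mul_cos_arg b, ← Complex.norm_mul_sin_arg b]
  ring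

lemma norm_mul_sin_ccwAngle_sub (a b c : ℂ) :
    ‖b‖ * ‖c‖ * Real.sin (ccwAngle a c - ccwAngle a b) = ω b c := by
  rw [← norm_mul_sin_ccwAngle, ← Real.Angle.sin_coe, ← Real.Angle.sin_coe, Real.Angle.coe_sub]
  simp only [coe_ccwAngle, sub_sub_sub_cancel_right]

lemma ccwAngle_lt_pi_iff (ha : a ≠ 0) (hb : b ≠ 0) :
    ccwAngle a b < Real.pi ↔ 0 < ω a b := by
  rw [← norm_mul_sin_ccwAngle,
    mul_pos_iff_of_pos_left (mul_pos (norm_pos_iff.2 ha) (norm_pos_iff.2 hb))]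
  refine ⟨Real.sin_pos_of_pos_of_lt_pi ccwAngle_pos, fun sin_pos => ?_⟩
  by_contra! pi_le
  have sin_sub_pi_nonneg := Real.sin_nonneg_of_nonneg_of_le_pi (sub_nonneg.2 pi_le)
    (by linarith [ccwAngle_le (a := a) (b := b)])
  rw [Real.sin_sub_pi] at sin_sub_pi_nonneg
  linarith

lemma ne_zero_of_areaForm_pos (h : 0 < ω a b) : a ≠ 0 ∧ b ≠ 0 :=
  ⟨fun ha => by simp [ha] at h, fun hb => by simp [hb] at h⟩

lemma ccwAngle_lt_pi_of_areaForm_pos (h : 0 < ω a b) : ccwAngle a b < Real.pi :=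
  let ⟨ha, hb⟩ := ne_zero_of_areaForm_pos h
  (ccwAngle_lt_pi_iff ha hb).2 h

lemma ccwAngle_lt_of_areaForm_pos (hab : 0 < ω a b) (hbc : 0 < ω b c) :
    ccwAngle a b < ccwAngle a c := by
  have lt_ab := ccwAngle_lt_pi_of_areaForm_pos hab
  have lt_bc := ccwAngle_lt_pi_of_areaForm_pos hbc
  rw [← ccwAngle_add (c := c) (by linarith)]
  exact lt_add_of_pos_right _ ccwAngle_pos

lemma ccwAngle_eq_angle (h : 0 < ω a b) :
    ccwAngle a b = InnerProductGeometry.angle a b := by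
  obtain ⟨ha, hb⟩ := ne_zero_of_areaForm_pos h
  refine Real.injOn_cos ⟨ccwAngle_pos.le, (ccwAngle_lt_pi_of_areaForm_pos h).le⟩
    ⟨InnerProductGeometry.angle_nonneg _ _, InnerProductGeometry.angle_le_pi _ _⟩ ?_
  rw [InnerProductGeometry.cos_angle, ← norm_mul_cos_ccwAngle]
  exact (mul_div_cancel_left₀ _ (mul_ne_zero (norm_ne_zero_iff.2 ha) (norm_ne_zero_iff.2 hb))).symm

end CcwAngle

section CyclicOrder

lemma finRotate_castSucc {n : ℕ} (i : Fin n) : finRotate (n + 1) i.castSucc = i.succ := by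
  rw [finRotate_apply, Fin.coeSucc_eq_succ]

lemma sameCycle_finRotate {n : ℕ} (i j : Fin (n + 1)) : (finRotate (n + 1)).SameCycle i j := by
  have zero_sameCycle : ∀ k, (finRotate (n + 1)).SameCycle 0 k :=
    Fin.induction (Equiv.Perm.SameCycle.refl _ _) fun k hk => by
      rwa [← finRotate_castSucc, Equiv.Perm.sameCycle_apply_right]
  exact (zero_sameCycle i).symm.trans (zero_sameCycle j)

variable {n : ℕ} {f : Fin (n + 1) → ℂ}

lemma ccwAngle_finRotate_le (hf : StrictMono fun i => Complex.arg (f i)) (i j : Fin (n + 1)) :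
    ccwAngle (f i) (f (finRotate (n + 1) i)) ≤ ccwAngle (f i) (f j) := by
  induction i using Fin.lastCases with
  | last =>
    rw [finRotate_last, ccwAngle_of_arg_le (hf.monotone (Fin.zero_le _)),
      ccwAngle_of_arg_le (hf.monotone (Fin.le_last _))]
    gcongr
    exact hf.monotone (Fin.zero_le _)
  | cast i =>
    rw [finRotate_castSucc, ccwAngle_of_arg_lt (hf Fin.castSucc_lt_succ)]
    rcases lt_or_ge i.castSucc j with lt | ge
    · rw [ccwAngle_of_arg_lt (hf lt)]
      gcongr
      exact hf.monotone (Fin.castSucc_lt_iff_succ_le.1 lt)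
    · rw [ccwAngle_of_arg_le (hf.monotone ge)]
      linarith [Complex.arg_le_pi (f i.succ), Complex.neg_pi_lt_arg (f j)]

lemma sum_ccwAngle_finRotate (hf : StrictMono fun i => Complex.arg (f i)) :
    ∑ i, ccwAngle (f i) (f (finRotate (n + 1) i)) = 2 * Real.pi := by
  rw [Fin.sum_univ_castSucc, finRotate_last, ccwAngle_of_arg_le (hf.monotone (Fin.zero_le _))]
  simp only [finRotate_castSucc, ccwAngle_of_arg_lt (hf Fin.castSucc_lt_succ),
    Finset.sum_sub_distrib]
  have split_last := Fin.sum_univ_castSucc fun i => Complex.arg (f i)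
  have split_zero := Fin.sum_univ_succ fun i => Complex.arg (f i)
  linarith

lemma exists_perm_ccwAngle_le {ι : Type*} [Fintype ι] [Nonempty ι] (f : ι → ℂ)
    (hf : Function.Injective fun i => Complex.arg (f i)) :
    ∃ σ : Equiv.Perm ι, (∀ i j, ccwAngle (f i) (f (σ i)) ≤ ccwAngle (f i) (f j)) ∧
      ∑ i, ccwAngle (f i) (f (σ i)) = 2 * Real.pi ∧ ∀ i j, σ.SameCycle i j := by
  let : LinearOrder ι := LinearOrder.lift' (fun i => Complex.arg (f i)) hf
  obtain ⟨n, hn⟩ := Nat.exists_eq_succ_of_ne_zero (Fintype.card_ne_zero (α := ι))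
  let e : Fin (n + 1) ≃o ι := monoEquivOfFin ι hn
  have mono : StrictMono fun i => Complex.arg (f (e i)) := fun _ _ hij => e.strictMono hij
  let φ := e.toEquiv.permCongrHom
  have φ_apply (ρ : Equiv.Perm (Fin (n + 1))) (i : Fin (n + 1)) : φ ρ (e i) = e (ρ i) :=
    (e.toEquiv.permCongr_apply ρ _).trans (congr_arg (fun k => e (ρ k)) (e.symm_apply_apply i))
  refine ⟨φ (finRotate (n + 1)), e.surjective.forall₂.2 fun i j => ?_, ?_,
    e.surjective.forall₂.2 fun i j => ?_⟩
  · rw [φ_apply]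
    exact ccwAngle_finRotate_le mono i j
  · rw [← e.toEquiv.sum_comp, ← sum_ccwAngle_finRotate mono]
    exact Finset.sum_congr rfl fun i _ => by rw [RelIso.coe_fn_toEquiv, φ_apply]
  · obtain ⟨k, hk⟩ := sameCycle_finRotate i j
    exact ⟨k, by rw [← map_zpow, φ_apply, hk]⟩

end CyclicOrder

/-- Twice the signed area of the triangle `abc`, positive if it is traversed counterclockwise. The
functions `orientedArea b c`, `orientedArea c a` and `orientedArea a b` are the barycentric
coordinates with respect to `abc`, up to the factor `orientedArea a b c`. -/
noncomputable def orientedArea (a b c : ℂ) : ℝ := ω (b - a) (c - a)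

/-- The closed triangle with counterclockwise vertices `a`, `b`, `c`, as an intersection of
half-planes. -/
def InTriangle (a b c q : ℂ) : Prop :=
  0 ≤ orientedArea b c q ∧ 0 ≤ orientedArea c a q ∧ 0 ≤ orientedArea a b q

section OrientedArea

variable {a b c p q : ℂ}

lemma orientedArea_apply (a b c : ℂ) : orientedArea a b c =
    (b.re - a.re) * (c.im - a.im) - (b.im - a.im) * (c.re - a.re) := by
  rw [orientedArea, areaForm_apply, Complex.sub_re, Complex.sub_im, Complex.sub_re, Complex.sub_im]

lemma orientedArea_rotate (a b c : ℂ) : orientedArea b c a = orientedArea a b c := by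
  simp only [orientedArea_apply]
  ring

lemma orientedArea_swap (a b c : ℂ) : orientedArea b a c = -orientedArea a b c := by
  simp only [orientedArea_apply]
  ring

@[simp] lemma orientedArea_self_left (a b : ℂ) : orientedArea a b a = 0 := by
  rw [orientedArea, sub_self, map_zero]

@[simp] lemma orientedArea_self_right (a b : ℂ) : orientedArea a b b = 0 := by
  rw [orientedArea, Orientation.areaForm_apply_self]

lemma orientedArea_add (a b c q : ℂ) :
    orientedArea b c q + orientedArea c a q + orientedArea a b q = orientedArea a b c := by
  simp only [orientedArea_apply]
  ring

lemma orientedArea_smul_eq (a b c q : ℂ) : orientedArea a b c • q =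
    orientedArea b c q • a + orientedArea c a q • b + orientedArea a b q • c := by
  apply Complex.ext <;>
  · simp only [orientedArea_apply, Complex.add_re, Complex.add_im, Complex.smul_re,
      Complex.smul_im, smul_eq_mul]
    ring

lemma orientedArea_combo {s t : ℝ} (hst : s + t = 1) (a b p q : ℂ) :
    orientedArea a b (s • p + t • q) = s * orientedArea a b p + t * orientedArea a b q := by
  obtain rfl : s = 1 - t := by linarith
  simp only [orientedArea_apply, Complex.add_re, Complex.add_im, Complex.smul_re,
    Complex.smul_im, smul_eq_mul]
  ring

lemma continuous_orientedArea (a b : ℂ) : Continuous (orientedArea a b) := by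
  simp only [funext (orientedArea_apply a b)]
  fun_prop

lemma convex_orientedArea_nonneg (a b : ℂ) : Convex ℝ {q | 0 ≤ orientedArea a b q} := by
  intro p hp q hq s t hs ht hst
  rw [Set.mem_ofPred_eq, orientedArea_combo hst]
  exact add_nonneg (mul_nonneg hs hp) (mul_nonneg ht hq)

lemma mem_segment_of_orientedArea_eq_zero (pos : 0 < orientedArea a b c)
    (h : orientedArea c a q = 0) (hbc : 0 ≤ orientedArea b c q) (hab : 0 ≤ orientedArea a b q) :
    q ∈ segment ℝ a c := by
  refine ⟨orientedArea b c q / orientedArea a b c, orientedArea a b q / orientedArea a b c,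
    by positivity, by positivity, ?_, ?_⟩
  · rw [← add_div, div_eq_one_iff_eq pos.ne', ← orientedArea_add a b c q, h, add_zero]
  · have barycentric := orientedArea_smul_eq a b c q
    rw [h, zero_smul, add_zero] at barycentric
    rw [div_eq_inv_mul, div_eq_inv_mul, mul_smul, mul_smul, ← smul_add, ← barycentric,
      inv_smul_smul₀ pos.ne']

lemma exists_orientedArea_le_of_mem_segment {x y : ℂ} (hq : q ∈ segment ℝ x y) (a b : ℂ) :
    orientedArea a b q ≤ orientedArea a b x ∨ orientedArea a b q ≤ orientedArea a b y := by
  obtain ⟨s, t, hs, ht, hst, rfl⟩ := hq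
  rw [orientedArea_combo hst]
  exact le_max_iff.1 (Convex.combo_le_max _ _ hs ht hst)

end OrientedArea

/-- A straight-line drawing of `T` in which an edge contains no vertices but its ends, and
different edges meet only in vertices. -/
structure IsPlaneDrawing {V : Type*} (z : V → ℂ) (T : SimpleGraph V) : Prop where
  injective : Function.Injective z
  vertex : ∀ u v x, T.Adj u v → z x ∈ segment ℝ (z u) (z v) → x = u ∨ x = v
  edge : ∀ u v x y, T.Adj u v → T.Adj x y → s(u, v) ≠ s(x, y) →
    ∀ q ∈ segment ℝ (z u) (z v), q ∈ segment ℝ (z x) (z y) → ∃ t, q = z t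

namespace IsPlaneDrawing

variable {V : Type*} {z : V → ℂ} {T : SimpleGraph V} {u v x y y' : V} {p q : ℂ}

lemma sup_edge (hT : IsPlaneDrawing z T)
    (hvert : ∀ x, z x ∈ segment ℝ (z u) (z v) → x = u ∨ x = v)
    (hedge : ∀ x y, T.Adj x y → s(x, y) ≠ s(u, v) → ∀ q ∈ segment ℝ (z u) (z v),
      q ∈ segment ℝ (z x) (z y) → ∃ t, q = z t) :
    IsPlaneDrawing z (T ⊔ SimpleGraph.edge u v) := by
  have adj_or_eq {x y : V} (h : (T ⊔ SimpleGraph.edge u v).Adj x y) :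
      T.Adj x y ∨ s(x, y) = s(u, v) := by
    rw [SimpleGraph.sup_adj, SimpleGraph.edge_adj] at h
    exact h.imp_right fun h => Sym2.eq_iff.2 h.1
  have segment_eq {x y : V} (h : s(x, y) = s(u, v)) :
      segment ℝ (z x) (z y) = segment ℝ (z u) (z v) := by
    rcases Sym2.eq_iff.1 h with ⟨rfl, rfl⟩ | ⟨rfl, rfl⟩
    exacts [rfl, segment_symm ℝ _ _]
  refine ⟨hT.injective, fun a b x hab hx => ?_, fun a b x y hab hxy hne q hq hq' => ?_⟩
  · rcases adj_or_eq hab with hab | hab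
    · exact hT.vertex a b x hab hx
    · rw [← Sym2.mem_iff, hab, Sym2.mem_iff]
      exact hvert x (segment_eq hab ▸ hx)
  · rcases adj_or_eq hab with hab | hab <;> rcases adj_or_eq hxy with hxy | hxy
    · exact hT.edge a b x y hab hxy hne q hq hq'
    · exact hedge a b hab (hxy ▸ hne) q (segment_eq hxy ▸ hq') hq
    · exact hedge x y hxy (hab ▸ hne.symm) q (segment_eq hab ▸ hq) hq'
    · exact absurd (hab.trans hxy.symm) hne

lemma adj_of_maximal (hT : Maximal (IsPlaneDrawing z) T) (huv : u ≠ v)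
    (hvert : ∀ x, z x ∈ segment ℝ (z u) (z v) → x = u ∨ x = v)
    (hedge : ∀ x y, T.Adj x y → s(x, y) ≠ s(u, v) → ∀ q ∈ segment ℝ (z u) (z v),
      q ∈ segment ℝ (z x) (z y) → ∃ t, q = z t) : T.Adj u v :=
  hT.le_of_ge (hT.prop.sup_edge hvert hedge) le_sup_left <|
    SimpleGraph.sup_adj _ _ _ _ |>.2 <| Or.inr <| (SimpleGraph.edge_adj _ _ _ _).2
      ⟨Or.inl ⟨rfl, rfl⟩, huv⟩

lemma eq_of_edge_meets_leg (hT : IsPlaneDrawing z T) (hux : T.Adj u x) (hyy' : T.Adj y y')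
    (huy : u ≠ y) (huy' : u ≠ y') (hq : q ∈ segment ℝ (z y) (z y'))
    (hq_off : orientedArea (z u) (z x) q ≠ 0) (hpx : p ∈ segment ℝ (z u) (z x))
    (hpy : p ∈ segment ℝ q (z y)) : x = y := by
  have p_mem : p ∈ segment ℝ (z y) (z y') :=
    (convex_segment _ _).segment_subset hq (left_mem_segment ℝ _ _) hpy
  have edges_ne : s(u, x) ≠ s(y, y') := fun h =>
    (Sym2.mem_iff.1 (h ▸ Sym2.mem_mk_left u x)).elim huy huy'
  obtain ⟨t, rfl⟩ := hT.edge _ _ _ _ hux hyy' edges_ne p hpx p_mem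
  have t_end := hT.vertex y y' t hyy' p_mem
  rcases hT.vertex u x t hux hpx with rfl | rfl
  · exact absurd t_end (not_or.2 ⟨huy, huy'⟩)
  · refine t_end.resolve_right ?_
    rintro rfl
    rw [segment_symm, mem_segment_iff_wbtw] at hpy
    rw [mem_segment_iff_wbtw] at hq
    exact hq_off ((wbtw_swap_right_iff ℝ _).1 ⟨hq, hpy⟩ ▸ orientedArea_self_right _ _)

end IsPlaneDrawing

/-- The edges `uv` and `uw` span, counterclockwise from `v` to `w`, an angle less than `π` whose
interior contains no edge at `u`. -/
structure IsSector {V : Type*} (z : V → ℂ) (T : SimpleGraph V) (u v w : V) : Prop where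
  left : T.Adj u v
  right : T.Adj u w
  pos : 0 < orientedArea (z u) (z v) (z w)
  cone : ∀ x, T.Adj u x →
    ¬(0 < orientedArea (z u) (z v) (z x) ∧ 0 < orientedArea (z w) (z u) (z x))

namespace IsSector

variable {V : Type*} {z : V → ℂ} {T : SimpleGraph V} {u v w y y' : V} {q : ℂ}

lemma not_mem_segment_of_adj (h : IsSector z T u v w) (hy : T.Adj u y)
    (hA : 0 < orientedArea (z w) (z u) q) (hB : 0 < orientedArea (z u) (z v) q) :
    q ∉ segment ℝ (z u) (z y) := by
  rintro ⟨s, t, -, ht, hst, rfl⟩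
  rw [orientedArea_combo hst, orientedArea_self_right, mul_zero, zero_add] at hA
  rw [orientedArea_combo hst, orientedArea_self_left, mul_zero, zero_add] at hB
  exact h.cone y hy ⟨pos_of_mul_pos_right hB ht, pos_of_mul_pos_right hA ht⟩

lemma ne_of_mem_segment (h : IsSector z T u v w) (hy : T.Adj y y')
    (hq : q ∈ segment ℝ (z y) (z y')) (hA : 0 < orientedArea (z w) (z u) q)
    (hB : 0 < orientedArea (z u) (z v) q) : u ≠ y ∧ u ≠ y' := by
  constructor
  · rintro rfl
    exact h.not_mem_segment_of_adj hy hA hB hq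
  · rintro rfl
    exact h.not_mem_segment_of_adj hy.symm hA hB (segment_symm ℝ (z y) (z u) ▸ hq)

/-- Otherwise the edge would leave the triangle between `q` and `y` through `uv` or `uw`. -/
lemma inTriangle_of_mem_segment (hT : IsPlaneDrawing z T) (h : IsSector z T u v w)
    (hy : T.Adj y y') (hq : q ∈ segment ℝ (z y) (z y')) (hA : 0 < orientedArea (z w) (z u) q)
    (hB : 0 < orientedArea (z u) (z v) q) (hCq : 0 ≤ orientedArea (z v) (z w) q)
    (hCy : 0 ≤ orientedArea (z v) (z w) (z y)) : InTriangle (z u) (z v) (z w) (z y) := by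
  set g : ℂ → ℝ := fun p => min (orientedArea (z w) (z u) p) (orientedArea (z u) (z v) p)
  suffices 0 ≤ g (z y) from ⟨hCy, le_min_iff.1 this⟩
  by_contra! g_neg
  obtain ⟨p, hp, g_zero⟩ : ∃ p ∈ segment ℝ q (z y), g p = 0 :=
    (convex_segment q (z y)).isPreconnected.intermediate_value (right_mem_segment ℝ _ _)
      (left_mem_segment ℝ _ _) ((continuous_orientedArea _ _).min
        (continuous_orientedArea _ _)).continuousOn ⟨g_neg.le, (lt_min hA hB).le⟩
  have hCp := (convex_orientedArea_nonneg (z v) (z w)).segment_subset hCq hCy hp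
  obtain ⟨huy, huy'⟩ := h.ne_of_mem_segment hy hq hA hB
  have pos_left : 0 < orientedArea (z v) (z w) (z u) := by rw [orientedArea_rotate]; exact h.pos
  have pos_right : 0 < orientedArea (z w) (z u) (z v) := by rwa [orientedArea_rotate]
  rcases min_eq_iff.1 g_zero with ⟨hAp, hBp⟩ | ⟨hBp, hAp⟩
  · obtain rfl := hT.eq_of_edge_meets_leg h.right hy huy huy' hq
      (by rw [orientedArea_swap]; exact (neg_neg_of_pos hA).ne)
      (mem_segment_of_orientedArea_eq_zero h.pos hAp hCp (hAp ▸ hBp)) hp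
    exact g_neg.not_ge (le_min (orientedArea_self_left _ _).ge h.pos.le)
  · have p_mem := mem_segment_of_orientedArea_eq_zero pos_left hBp (hBp ▸ hAp) hCp
    obtain rfl := hT.eq_of_edge_meets_leg h.left hy huy huy' hq hB.ne'
      (segment_symm ℝ (z v) (z u) ▸ p_mem) hp
    exact g_neg.not_ge (le_min pos_right.le (orientedArea_self_right _ _).ge)

lemma exists_inTriangle_of_crossing (hT : IsPlaneDrawing z T) (h : IsSector z T u v w)
    (hy : T.Adj y y') (hq : q ∈ segment ℝ (z y) (z y')) (hA : 0 < orientedArea (z w) (z u) q)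
    (hB : 0 < orientedArea (z u) (z v) q) (hC : 0 ≤ orientedArea (z v) (z w) q) :
    ∃ t t', s(t, t') = s(y, y') ∧ InTriangle (z u) (z v) (z w) (z t) ∧
      orientedArea (z v) (z w) q ≤ orientedArea (z v) (z w) (z t) := by
  rcases exists_orientedArea_le_of_mem_segment hq (z v) (z w) with le | le
  · exact ⟨y, y', rfl, h.inTriangle_of_mem_segment hT hy hq hA hB hC (hC.trans le), le⟩
  · exact ⟨y', y, Sym2.eq_swap, h.inTriangle_of_mem_segment hT hy.symm
      (segment_symm ℝ (z y) (z y') ▸ hq) hA hB hC (hC.trans le), le⟩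

lemma pos_of_inTriangle (hT : IsPlaneDrawing z T) (h : IsSector z T u v w) {x : V}
    (hx : InTriangle (z u) (z v) (z w) (z x)) (hne : ¬(x = u ∨ x = v ∨ x = w)) :
    0 < orientedArea (z w) (z u) (z x) ∧ 0 < orientedArea (z u) (z v) (z x) := by
  obtain ⟨hC, hA, hB⟩ := hx
  push Not at hne
  refine ⟨hA.lt_of_ne fun zero => ?_, hB.lt_of_ne fun zero => ?_⟩
  · exact (hT.vertex u w x h.right
      (mem_segment_of_orientedArea_eq_zero h.pos zero.symm hC hB)).elim hne.1 hne.2.2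
  · have pos : 0 < orientedArea (z v) (z w) (z u) := by rw [orientedArea_rotate]; exact h.pos
    exact (hT.vertex v u x h.left.symm
      (mem_segment_of_orientedArea_eq_zero pos zero.symm hA hC)).elim hne.2.1 hne.1

lemma adj_of_forall_farther_eq (hT : Maximal (IsPlaneDrawing z) T) (h : IsSector z T u v w)
    {x : V} (hA : 0 < orientedArea (z w) (z u) (z x)) (hB : 0 < orientedArea (z u) (z v) (z x))
    (hC : 0 ≤ orientedArea (z v) (z w) (z x))
    (eq_of_farther : ∀ t, InTriangle (z u) (z v) (z w) (z t) →
      orientedArea (z v) (z w) (z x) < orientedArea (z v) (z w) (z t) → t = u) : T.Adj u x := by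
  have hCu : orientedArea (z v) (z w) (z x) < orientedArea (z v) (z w) (z u) := by
    rw [orientedArea_rotate (z u), ← orientedArea_add (z u) (z v) (z w) (z x)]
    linarith
  have coords {q : ℂ} (hq : q ∈ segment ℝ (z u) (z x)) (hqu : q ≠ z u) (hqx : q ≠ z x) :
      0 < orientedArea (z w) (z u) q ∧ 0 < orientedArea (z u) (z v) q ∧
        orientedArea (z v) (z w) (z x) < orientedArea (z v) (z w) q := by
    obtain ⟨s, t, hs, ht, hst, rfl⟩ := mem_openSegment_of_ne_left_right hqu.symm hqx.symm hq
    simp only [orientedArea_combo hst, orientedArea_self_left, orientedArea_self_right, mul_zero,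
      zero_add]
    refine ⟨mul_pos ht hA, mul_pos ht hB, ?_⟩
    obtain rfl : t = 1 - s := by linarith
    nlinarith [mul_pos hs (sub_pos.2 hCu)]
  refine IsPlaneDrawing.adj_of_maximal hT ?_ (fun t ht => ?_) fun y y' hy _ q hq hqy => ?_
  · rintro rfl
    exact hA.ne' (orientedArea_self_right _ _)
  · by_contra! t_new
    obtain ⟨hAt, hBt, hCt⟩ := coords ht (hT.prop.injective.ne t_new.1)
      (hT.prop.injective.ne t_new.2)
    exact t_new.1 (eq_of_farther t ⟨hC.trans hCt.le, hAt.le, hBt.le⟩ hCt)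
  · by_contra! q_new
    obtain ⟨hAq, hBq, hCq⟩ := coords hq (q_new u) (q_new x)
    obtain ⟨t, t', ends_eq, ht, hCt⟩ :=
      h.exists_inTriangle_of_crossing hT.prop hy hqy hAq hBq (hC.trans hCq.le)
    obtain ⟨huy, huy'⟩ := h.ne_of_mem_segment hy hqy hAq hBq
    have u_mem : u ∈ s(y, y') := by
      rw [← ends_eq, ← eq_of_farther t ht (hCq.trans_le hCt)]
      exact Sym2.mem_mk_left _ _
    exact (Sym2.mem_iff.1 u_mem).elim huy huy'

/-- Otherwise `u` could be joined to the vertex in the triangle that is farthest from `vw`. -/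
lemma eq_of_inTriangle [Finite V] (hT : Maximal (IsPlaneDrawing z) T) (h : IsSector z T u v w)
    {x : V} (hx : InTriangle (z u) (z v) (z w) (z x)) : x = u ∨ x = v ∨ x = w := by
  by_contra x_new
  obtain ⟨x, ⟨hx, x_new⟩, farthest⟩ := Set.exists_max_image
    {x | InTriangle (z u) (z v) (z w) (z x) ∧ ¬(x = u ∨ x = v ∨ x = w)}
    (fun x => orientedArea (z v) (z w) (z x)) (Set.toFinite _) ⟨x, hx, x_new⟩
  obtain ⟨hA, hB⟩ := h.pos_of_inTriangle hT.prop hx x_new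
  refine h.cone x (h.adj_of_forall_farther_eq hT hA hB hx.1 fun t ht hlt => ?_) ⟨hB, hA⟩
  have hCt := hx.1.trans_lt hlt
  have t_old : t = u ∨ t = v ∨ t = w := by_contra fun t_new => (farthest t ⟨ht, t_new⟩).not_gt hlt
  rcases t_old with rfl | rfl | rfl
  · rfl
  · exact absurd (orientedArea_self_left _ _) hCt.ne'
  · exact absurd (orientedArea_self_right _ _) hCt.ne'

lemma eq_or_eq_of_mem_segment [Finite V] (hT : Maximal (IsPlaneDrawing z) T)
    (h : IsSector z T u v w) (hy : T.Adj y y') (hq : q ∈ segment ℝ (z y) (z y'))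
    (hA : 0 < orientedArea (z w) (z u) q) (hB : 0 < orientedArea (z u) (z v) q)
    (hC : orientedArea (z v) (z w) q = 0) (hCy : 0 ≤ orientedArea (z v) (z w) (z y)) :
    y = v ∨ y = w :=
  (h.eq_of_inTriangle hT (h.inTriangle_of_mem_segment hT.prop hy hq hA hB hC.ge hCy)).resolve_left
    (h.ne_of_mem_segment hy hq hA hB).1.symm

lemma edge_eq_of_mem_segment [Finite V] (hT : Maximal (IsPlaneDrawing z) T)
    (h : IsSector z T u v w) (hy : T.Adj y y') (hq : q ∈ openSegment ℝ (z y) (z y'))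
    (hA : 0 < orientedArea (z w) (z u) q) (hB : 0 < orientedArea (z u) (z v) q)
    (hC : orientedArea (z v) (z w) q = 0) (hCy : 0 ≤ orientedArea (z v) (z w) (z y)) :
    s(y, y') = s(v, w) := by
  have hq' := openSegment_subset_segment ℝ _ _ hq
  have y_mem := h.eq_or_eq_of_mem_segment hT hy hq' hA hB hC hCy
  have hCy_zero : orientedArea (z v) (z w) (z y) = 0 := by
    rcases y_mem with rfl | rfl
    exacts [orientedArea_self_left _ _, orientedArea_self_right _ _]
  have hCy'_zero : orientedArea (z v) (z w) (z y') = 0 := by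
    obtain ⟨s, t, -, ht, hst, rfl⟩ := hq
    rw [orientedArea_combo hst, hCy_zero, mul_zero, zero_add] at hC
    exact (mul_eq_zero.1 hC).resolve_left ht.ne'
  have y'_mem := h.eq_or_eq_of_mem_segment hT hy.symm (segment_symm ℝ (z y) (z y') ▸ hq') hA hB hC
    hCy'_zero.ge
  rcases y_mem with rfl | rfl <;> rcases y'_mem with rfl | rfl
  exacts [absurd rfl hy.ne, rfl, Sym2.eq_swap, absurd rfl hy.ne]

lemma adj [Finite V] (hT : Maximal (IsPlaneDrawing z) T) (h : IsSector z T u v w) : T.Adj v w := by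
  have coords {q : ℂ} (hq : q ∈ segment ℝ (z v) (z w)) (hqv : q ≠ z v) (hqw : q ≠ z w) :
      0 < orientedArea (z w) (z u) q ∧ 0 < orientedArea (z u) (z v) q ∧
        orientedArea (z v) (z w) q = 0 := by
    obtain ⟨s, t, hs, ht, hst, rfl⟩ := mem_openSegment_of_ne_left_right hqv.symm hqw.symm hq
    have pos : 0 < orientedArea (z w) (z u) (z v) := by rw [← orientedArea_rotate]; exact h.pos
    simp only [orientedArea_combo hst, orientedArea_self_left, orientedArea_self_right,
      mul_zero, zero_add, add_zero, and_true]
    exact ⟨mul_pos hs pos, mul_pos ht h.pos⟩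
  refine IsPlaneDrawing.adj_of_maximal hT ?_ (fun t ht => ?_) fun y y' hy hne q hq hqy => ?_
  · rintro rfl
    exact h.pos.ne' (orientedArea_self_right _ _)
  · by_contra! t_new
    obtain ⟨hA, hB, hC⟩ := coords ht (hT.prop.injective.ne t_new.1) (hT.prop.injective.ne t_new.2)
    refine (h.eq_of_inTriangle hT ⟨hC.ge, hA.le, hB.le⟩).elim ?_ (not_or.2 t_new)
    rintro rfl
    exact hA.ne' (orientedArea_self_right _ _)
  · by_contra! q_new
    obtain ⟨hA, hB, hC⟩ := coords hq (q_new v) (q_new w)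
    have hqy' := mem_openSegment_of_ne_left_right (q_new y).symm (q_new y').symm hqy
    rcases exists_orientedArea_le_of_mem_segment hqy (z v) (z w) with le | le
    · exact hne (h.edge_eq_of_mem_segment hT hy hqy' hA hB hC (hC ▸ le))
    · exact hne (Sym2.eq_swap.trans (h.edge_eq_of_mem_segment hT hy.symm
        (openSegment_symm ℝ (z y) (z y') ▸ hqy') hA hB hC (hC ▸ le)))

lemma not_adj_of_pos [Finite V] (hT : Maximal (IsPlaneDrawing z) T) (h : IsSector z T u v w)
    {x : V} (hB : 0 < orientedArea (z u) (z v) (z x)) (hC : 0 < orientedArea (z v) (z w) (z x)) :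
    ¬T.Adj v x := by
  intro hvx
  rcases le_or_gt 0 (orientedArea (z w) (z u) (z x)) with hA | hA
  · rcases h.eq_of_inTriangle hT ⟨hC.le, hA, hB.le⟩ with rfl | rfl | rfl
    · exact hB.ne' (orientedArea_self_left _ _)
    · exact T.irrefl hvx
    · exact hC.ne' (orientedArea_self_right _ _)
  · set D := orientedArea (z u) (z v) (z w)
    set A := orientedArea (z w) (z u) (z x)
    have hD_pos : 0 < D := h.pos
    have hAv : orientedArea (z w) (z u) (z v) = D := by rw [← orientedArea_rotate]
    have hDA : 0 < D - A := by linarith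
    -- The weights make `orientedArea (z w) (z u)` equal to `D / 2` at `q`.
    set s := D / (2 * (D - A)) with hs
    have hs_pos : 0 < s := by positivity
    have hst : s + (1 - s) = 1 := add_sub_cancel _ _
    set q := s • z x + (1 - s) • z v with hq
    have q_mem : q ∈ segment ℝ (z x) (z v) := by
      refine ⟨s, 1 - s, hs_pos.le, sub_nonneg.2 ?_, hst, rfl⟩
      rw [hs, div_le_one (by positivity)]
      linarith
    have hAq : orientedArea (z w) (z u) q = D / 2 := by
      rw [hq, orientedArea_combo hst, hAv, hs]
      field_simp
      ring
    have hBq : orientedArea (z u) (z v) q = s * orientedArea (z u) (z v) (z x) := by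
      rw [hq, orientedArea_combo hst, orientedArea_self_right, mul_zero, add_zero]
    have hCq : orientedArea (z v) (z w) q = s * orientedArea (z v) (z w) (z x) := by
      rw [hq, orientedArea_combo hst, orientedArea_self_left, mul_zero, add_zero]
    have hx := h.inTriangle_of_mem_segment hT.prop hvx.symm q_mem (hAq ▸ half_pos hD_pos)
      (hBq ▸ mul_pos hs_pos hB) (hCq ▸ (mul_pos hs_pos hC).le) hC.le
    exact hA.not_ge hx.2.1

end IsSector

lemma exists_perm_of_fibers {α β : Type*} (f : α → β) (σ : ∀ b, Equiv.Perm {a // f a = b}) :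
    ∃ N : Equiv.Perm α, ∀ b (a : {a // f a = b}), N a = σ b a := by
  refine ⟨(Equiv.sigmaFiberEquiv f).permCongr (Equiv.sigmaCongrRight σ), ?_⟩
  rintro _ ⟨a, rfl⟩
  rfl

/-- The direction of a dart in the drawing `z`. -/
def dartDir {V : Type*} {T : SimpleGraph V} (z : V → ℂ) (d : T.Dart) : ℂ := z d.snd - z d.fst

/-- The rotation system of a drawing: `N d` is the counterclockwise successor of the dart `d` among
the darts with the same initial vertex. The darts at a vertex form a single cycle of `N`. -/
structure IsRotation {V : Type*} {T : SimpleGraph V} [Fintype T.Dart] [DecidableEq V]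
    (z : V → ℂ) (N : Equiv.Perm T.Dart) : Prop where
  fst : ∀ d, (N d).fst = d.fst
  le : ∀ d d' : T.Dart, d'.fst = d.fst →
    ccwAngle (dartDir z d) (dartDir z (N d)) ≤ ccwAngle (dartDir z d) (dartDir z d')
  sum : ∀ d₀ : T.Dart, ∑ d with d.fst = d₀.fst, ccwAngle (dartDir z d) (dartDir z (N d)) =
    2 * Real.pi
  sameCycle : ∀ d d' : T.Dart, d.fst = d'.fst → N.SameCycle d d'

namespace IsPlaneDrawing

variable {V : Type*} {z : V → ℂ} {T : SimpleGraph V} {u v w : V}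

lemma dartDir_ne_zero (hT : IsPlaneDrawing z T) (d : T.Dart) : dartDir z d ≠ 0 :=
  sub_ne_zero.2 fun h => d.adj.ne (hT.injective h).symm

lemma eq_of_sameRay (hT : IsPlaneDrawing z T) (huv : T.Adj u v) (huw : T.Adj u w)
    (h : SameRay ℝ (z v - z u) (z w - z u)) : v = w := by
  rcases wbtw_total_of_sameRay_vsub_left (R := ℝ) (x := z u) (y := z v) (z := z w) h with h | h
  · exact (hT.vertex u w v huw (mem_segment_iff_wbtw.2 h)).resolve_left huv.ne'
  · exact ((hT.vertex u v w huv (mem_segment_iff_wbtw.2 h)).resolve_left huw.ne').symm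

lemma dart_eq_of_arg_eq (hT : IsPlaneDrawing z T) {d d' : T.Dart} (hd : d.fst = d'.fst)
    (h : Complex.arg (dartDir z d) = Complex.arg (dartDir z d')) : d = d' := by
  have sameRay := Complex.sameRay_of_arg_eq h
  rw [dartDir, dartDir, ← hd] at sameRay
  exact SimpleGraph.Dart.ext _ _ (Prod.ext hd (hT.eq_of_sameRay d.adj (hd ▸ d'.adj) sameRay))

lemma exists_isRotation [Fintype T.Dart] [DecidableEq V] (hT : IsPlaneDrawing z T) :
    ∃ N : Equiv.Perm T.Dart, IsRotation z N := by
  have exists_local (u : V) : ∃ σ : Equiv.Perm {d : T.Dart // d.fst = u},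
      (∀ i j : {d : T.Dart // d.fst = u}, ccwAngle (dartDir z i.1) (dartDir z (σ i).1) ≤
        ccwAngle (dartDir z i.1) (dartDir z j.1)) ∧
      (Nonempty {d : T.Dart // d.fst = u} →
        ∑ i, ccwAngle (dartDir z i.1) (dartDir z (σ i).1) = 2 * Real.pi) ∧
      ∀ i j, σ.SameCycle i j := by
    rcases isEmpty_or_nonempty {d : T.Dart // d.fst = u} with _ | _
    · exact ⟨1, isEmptyElim, fun h => isEmptyElim h.some, isEmptyElim⟩
    · obtain ⟨σ, le, sum, sameCycle⟩ := exists_perm_ccwAngle_le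
        (fun i : {d : T.Dart // d.fst = u} => dartDir z i.1)
        fun i j hij => Subtype.ext (hT.dart_eq_of_arg_eq (i.2.trans j.2.symm) hij)
      exact ⟨σ, le, fun _ => sum, sameCycle⟩
  choose σ le sum sameCycle using exists_local
  obtain ⟨N, hN⟩ := exists_perm_of_fibers (fun d : T.Dart => d.fst) σ
  have hN' (d : T.Dart) : N d = (σ d.fst ⟨d, rfl⟩).1 := hN _ ⟨d, rfl⟩
  refine ⟨N, ⟨fun d => ?_, fun d d' h => ?_, fun d₀ => ?_, fun d d' h => ?_⟩⟩
  · rw [hN']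
    exact (σ d.fst ⟨d, rfl⟩).2
  · rw [hN']
    exact le d.fst ⟨d, rfl⟩ ⟨d', h⟩
  · rw [← sum d₀.fst ⟨⟨d₀, rfl⟩⟩, Finset.sum_subtype (p := fun d => d.fst = d₀.fst) _ (by simp)]
    exact Finset.sum_congr rfl fun i _ => by rw [hN]
  · obtain ⟨k, -, hk⟩ := (sameCycle d'.fst ⟨d, h⟩ ⟨d', rfl⟩).exists_pow_eq'
    have semiconj : Function.Semiconj Subtype.val (σ d'.fst) N := fun i => (hN _ i).symm
    refine ⟨(k : ℤ), ?_⟩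
    rw [zpow_natCast, ← Equiv.Perm.iterate_eq_pow,
      ← (semiconj.iterate_right k).eq ⟨d, h⟩, Equiv.Perm.iterate_eq_pow, hk]

end IsPlaneDrawing

namespace IsRotation

variable {V : Type*} {z : V → ℂ} {T : SimpleGraph V} [Fintype T.Dart] [DecidableEq V]
  {N : Equiv.Perm T.Dart}

lemma dartDir_apply (hN : IsRotation z N) (d : T.Dart) :
    dartDir z (N d) = z (N d).snd - z d.fst := by
  rw [dartDir, hN.fst]

lemma isSector (hN : IsRotation z N) (d : T.Dart)
    (hd : 0 < ω (dartDir z d) (dartDir z (N d))) : IsSector z T d.fst d.snd (N d).snd := by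
  rw [hN.dartDir_apply] at hd
  refine ⟨d.adj, hN.fst d ▸ (N d).adj, hd, fun x hx ⟨hB, hA⟩ => ?_⟩
  rw [orientedArea_rotate, orientedArea_rotate, orientedArea, ← hN.dartDir_apply] at hA
  exact (ccwAngle_lt_of_areaForm_pos hB hA).not_ge (hN.le d ⟨(d.fst, x), hx⟩ rfl)

lemma apply_eq_symm_of_fst_eq_of_snd_eq [Finite V] (hT : Maximal (IsPlaneDrawing z) T)
    (hN : IsRotation z N) (d d₁ : T.Dart) (hd : 0 < ω (dartDir z d) (dartDir z (N d)))
    (h₁ : d₁.fst = d.snd) (h₂ : d₁.snd = (N d).snd) : N d₁ = d.symm := by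
  have sector := hN.isSector d hd
  rcases (hN.le d₁ d.symm h₁.symm).eq_or_lt with heq | hlt
  · exact hT.prop.dart_eq_of_arg_eq ((hN.fst d₁).trans h₁) (arg_eq_of_ccwAngle_eq heq)
  have pos_d₁ : 0 < ω (dartDir z d₁) (dartDir z d.symm) := by
    rw [dartDir, dartDir, h₁, h₂]
    have pos := sector.pos
    rwa [← orientedArea_rotate] at pos
  have lt_pi := ccwAngle_lt_pi_of_areaForm_pos pos_d₁
  have pos_right : 0 < ω (dartDir z d₁) (dartDir z (N d₁)) :=
    (ccwAngle_lt_pi_iff (hT.prop.dartDir_ne_zero _) (hT.prop.dartDir_ne_zero _)).1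
      (hlt.trans lt_pi)
  have pos_left : 0 < ω (dartDir z (N d₁)) (dartDir z d.symm) := by
    rw [← norm_mul_sin_ccwAngle_sub (dartDir z d₁)]
    have angle_pos := ccwAngle_pos (a := dartDir z d₁) (b := dartDir z (N d₁))
    have := norm_pos_iff.2 (hT.prop.dartDir_ne_zero (N d₁))
    have := norm_pos_iff.2 (hT.prop.dartDir_ne_zero d.symm)
    have := Real.sin_pos_of_pos_of_lt_pi (sub_pos.2 hlt) (by linarith)
    positivity
  rw [hN.dartDir_apply, h₁] at pos_left pos_right
  rw [dartDir, h₁, h₂] at pos_right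
  refine absurd (h₁ ▸ hN.fst d₁ ▸ (N d₁).adj) (sector.not_adj_of_pos hT ?_ pos_right)
  rw [← orientedArea_rotate]
  exact pos_left

lemma exists_triangle [Finite V] (hT : Maximal (IsPlaneDrawing z) T) (hN : IsRotation z N)
    (d : T.Dart) (hd : 0 < ω (dartDir z d) (dartDir z (N d))) :
    (N.symm d.symm).fst = d.snd ∧ (N.symm d.symm).snd = (N d).snd ∧
      ω (dartDir z (N.symm d.symm)) (dartDir z d.symm) = ω (dartDir z d) (dartDir z (N d)) := by
  have sector := hN.isSector d hd
  have apply_eq := hN.apply_eq_symm_of_fst_eq_of_snd_eq hT d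
    ⟨(d.snd, (N d).snd), sector.adj hT⟩ hd rfl rfl
  have symm_eq := (Equiv.symm_apply_eq N).2 apply_eq.symm
  rw [symm_eq]
  refine ⟨rfl, rfl, ?_⟩
  rw [hN.dartDir_apply]
  exact orientedArea_rotate _ _ _

end IsRotation

/-- A set of darts with an edge involution `σ`, some of which (those with `tri d`) are grouped in
triangles by the face permutation `φ`. -/
structure IsTriangleMap {B : Type*} (σ φ : B → B) (tri : B → Prop) : Prop where
  invol : ∀ d, σ (σ d) = d
  ne_self : ∀ d, σ d ≠ d
  tri_next : ∀ d, tri d → tri (φ d)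
  next_three : ∀ d, tri d → φ (φ (φ d)) = d
  next_ne : ∀ d, tri d → φ d ≠ d

/-- The three darts of the triangle of `d`. -/
def triangle {B : Type*} [DecidableEq B] (φ : B → B) (d : B) : Finset B := {d, φ d, φ (φ d)}

/-- The darts with property `P` in the face `c`, where `comp` assigns to a dart its face. -/
def faceDarts {B C : Type*} [Fintype B] [DecidableEq C] (comp : B → C) (P : B → Prop)
    [DecidablePred P] (c : C) : Finset B :=
  {d | P d ∧ comp d = c}

lemma mem_faceDarts {B C : Type*} [Fintype B] [DecidableEq C] {comp : B → C} {P : B → Prop}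
    [DecidablePred P] {c : C} {d : B} : d ∈ faceDarts comp P c ↔ P d ∧ comp d = c := by
  simp only [faceDarts, Finset.mem_filter, Finset.mem_univ, true_and]

/-- The merging of triangles across the darts outside `G`: `comp` assigns to a dart its merged face,
all darts outside triangles belong to the outer face `O`, and `t` counts the triangles in a face. -/
structure IsMerging {B C : Type*} [Fintype B] [DecidableEq B] [DecidableEq C] (σ φ : B → B)
    (tri G : B → Prop) [DecidablePred tri] [DecidablePred G] (comp : B → C) (O : C) (t : C → ℕ) :
    Prop where
  comp_symm : ∀ d, ¬G d → comp (σ d) = comp d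
  comp_next : ∀ d, tri d → comp (φ d) = comp d
  comp_outer : ∀ d, ¬tri d → comp d = O
  card_tri : ∀ c, (faceDarts comp tri c).card = 3 * t c
  inner : ∀ c ≠ O, 2 * t c ≤ (faceDarts comp (fun d => ¬G d) c).card + 2
  outer : 2 * t O ≤ (faceDarts comp (fun d => ¬G d) O).card
  exists_symm : ∀ c, 2 ≤ t c → ∃ d, ¬G d ∧ comp d = c ∧ σ d ∉ triangle φ d

/-- The dual graph in which two nodes are joined when a dart of `R` leads from one to the other. -/
def dualGraph {B N : Type*} {σ : B → B} (hσ : ∀ d, σ (σ d) = d) {R : B → Prop}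
    (hR : ∀ d, R d → R (σ d)) (node : B → N) : SimpleGraph N where
  Adj A A' := A ≠ A' ∧ ∃ d, R d ∧ node d = A ∧ node (σ d) = A'
  symm := ⟨fun A A' ⟨hne, d, hd, h1, h2⟩ => ⟨hne.symm, σ d, hR d hd, h2, by rw [hσ, h1]⟩⟩
  loopless := ⟨fun _ h => h.1 rfl⟩

section dualGraph

variable {B N : Type*} {σ : B → B} (hσ : ∀ d, σ (σ d) = d) {R : B → Prop}
  (hR : ∀ d, R d → R (σ d)) (node : B → N)

lemma connectedComponentMk_dualGraph_symm {d : B} (hd : R d) :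
    (dualGraph hσ hR node).connectedComponentMk (node (σ d)) =
      (dualGraph hσ hR node).connectedComponentMk (node d) := by
  by_cases hne : node (σ d) = node d
  · rw [hne]
  · refine SimpleGraph.ConnectedComponent.sound (SimpleGraph.Adj.reachable ?_)
    exact ⟨hne, σ d, hR d hd, rfl, by rw [hσ]⟩

lemma two_mul_card_supp_le [Fintype B] [Finite N] [DecidablePred R]
    [DecidableEq (dualGraph hσ hR node).ConnectedComponent]
    (c : (dualGraph hσ hR node).ConnectedComponent) :
    2 * Nat.card c.supp ≤
      (faceDarts (fun d => (dualGraph hσ hR node).connectedComponentMk (node d)) R c).card + 2 := by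
  classical
  have := Fintype.ofFinite N
  have card_le : Nat.card c.supp ≤ Nat.card c.toSimpleGraph.edgeSet + 1 :=
    c.connected_toSimpleGraph.card_vert_le_card_edgeSet_add_one
  have two_mul_edges : 2 * Nat.card c.toSimpleGraph.edgeSet =
      Fintype.card c.toSimpleGraph.Dart := by
    rw [SimpleGraph.dart_card_eq_twice_card_edges, Nat.card_eq_fintype_card,
      SimpleGraph.edgeFinset_card]
  choose g hgR hg_fst hg_snd using fun δ : c.toSimpleGraph.Dart =>
    (show ∃ d, R d ∧ node d = δ.fst.1 ∧ node (σ d) = δ.snd.1 from δ.adj.2)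
  have card_darts_le : Fintype.card c.toSimpleGraph.Dart ≤
      (faceDarts (fun d => (dualGraph hσ hR node).connectedComponentMk (node d)) R c).card := by
    rw [← Finset.card_univ]
    refine Finset.card_le_card_of_injOn g (fun δ _ => ?_) fun δ _ δ' _ h => ?_
    · exact mem_faceDarts.2 ⟨hgR δ, by rw [hg_fst δ]; exact δ.fst.2⟩
    · refine SimpleGraph.Dart.ext _ _ (Prod.ext (Subtype.ext ?_) (Subtype.ext ?_))
      · rw [← hg_fst, ← hg_fst, h]
      · rw [← hg_snd, ← hg_snd, h]
  omega

end dualGraph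

lemma card_supp_option {Q : Type*} [Fintype Q] (Γ : SimpleGraph (Option Q))
    [DecidableEq Γ.ConnectedComponent] (c : Γ.ConnectedComponent) :
    Nat.card c.supp = (Finset.univ.filter fun q => Γ.connectedComponentMk (some q) = c).card +
      if c = Γ.connectedComponentMk none then 1 else 0 := by
  have supp_eq : c.supp = ((Finset.univ.filter fun A => Γ.connectedComponentMk A = c :
      Finset (Option Q)) : Set (Option Q)) := by
    ext A
    simp
  rw [supp_eq, Nat.card_coe_set_eq, Set.ncard_coe_finset, Finset.card_filter, Fintype.sum_option,
    ← Finset.card_filter, add_comm]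
  exact congrArg _ (if_congr eq_comm rfl rfl)

namespace IsTriangleMap

universe u

variable {B : Type u} [DecidableEq B] {σ φ : B → B} {tri : B → Prop}

lemma tri_of_mem_triangle (h : IsTriangleMap σ φ tri) {d d' : B} (hd : tri d)
    (hd' : d' ∈ triangle φ d) : tri d' := by
  simp only [triangle, Finset.mem_insert, Finset.mem_singleton] at hd'
  rcases hd' with rfl | rfl | rfl
  exacts [hd, h.tri_next _ hd, h.tri_next _ (h.tri_next _ hd)]

lemma triangle_eq_of_mem (h : IsTriangleMap σ φ tri) {d d' : B} (hd : tri d)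
    (hd' : d' ∈ triangle φ d) : triangle φ d' = triangle φ d := by
  have three := h.next_three d hd
  simp only [triangle, Finset.mem_insert, Finset.mem_singleton] at hd'
  rcases hd' with rfl | rfl | rfl <;> ext b <;>
    simp only [triangle, three, Finset.mem_insert, Finset.mem_singleton] <;> tauto

lemma card_triangle (h : IsTriangleMap σ φ tri) {d : B} (hd : tri d) :
    (triangle φ d).card = 3 := by
  have three := h.next_three d hd
  have ne₁ := h.next_ne d hd
  have ne₂ := h.next_ne _ (h.tri_next d hd)
  have ne₃ := h.next_ne _ (h.tri_next _ (h.tri_next d hd))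
  rw [three] at ne₃
  exact Finset.card_eq_three.2 ⟨d, φ d, φ (φ d), ne₁.symm, ne₃, ne₂.symm, rfl⟩

/-- The triangles, as classes of darts. -/
def triSetoid (h : IsTriangleMap σ φ tri) : Setoid {d // tri d} where
  r d d' := d.1 ∈ triangle φ d'.1
  iseqv := by
    have mem_self (d : B) : d ∈ triangle φ d := Finset.mem_insert_self _ _
    exact ⟨fun d => mem_self d.1, fun {_ d'} hd => h.triangle_eq_of_mem d'.2 hd ▸ mem_self _,
      fun {_ _ d''} hd hd' => h.triangle_eq_of_mem d''.2 hd' ▸ hd⟩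

variable [DecidablePred tri]

/-- The unmerged face of a dart: its triangle, or `none` for the darts outside all triangles. -/
def face (h : IsTriangleMap σ φ tri) (d : B) : Option (Quotient h.triSetoid) :=
  if hd : tri d then some (Quotient.mk _ ⟨d, hd⟩) else none

lemma face_of_tri (h : IsTriangleMap σ φ tri) {d : B} (hd : tri d) :
    h.face d = some (Quotient.mk _ ⟨d, hd⟩) := dif_pos hd

lemma face_of_not_tri (h : IsTriangleMap σ φ tri) {d : B} (hd : ¬tri d) : h.face d = none :=
  dif_neg hd

lemma tri_of_face_eq_some (h : IsTriangleMap σ φ tri) {d : B} {q : Quotient h.triSetoid}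
    (hq : h.face d = some q) : tri d := by
  by_contra hd
  simp [h.face_of_not_tri hd] at hq

lemma face_eq_face_iff (h : IsTriangleMap σ φ tri) {d d' : B} (hd : tri d) :
    h.face d' = h.face d ↔ d' ∈ triangle φ d := by
  refine ⟨fun heq => ?_, fun hmem => ?_⟩
  · have hd' : tri d' := h.tri_of_face_eq_some (heq.trans (h.face_of_tri hd))
    rw [h.face_of_tri hd, h.face_of_tri hd', Option.some_inj] at heq
    exact Quotient.exact heq
  · rw [h.face_of_tri hd, h.face_of_tri (h.tri_of_mem_triangle hd hmem)]
    exact congrArg some (Quotient.sound hmem)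

variable [Fintype B]

lemma card_faceDarts_tri (h : IsTriangleMap σ φ tri) [Fintype (Quotient h.triSetoid)] {C : Type*}
    [DecidableEq C] (f : Option (Quotient h.triSetoid) → C) (c : C) :
    (faceDarts (fun d => f (h.face d)) tri c).card =
      3 * (Finset.univ.filter fun q => f (some q) = c).card := by
  classical
  have mapsTo : ∀ d ∈ faceDarts (fun d => f (h.face d)) tri c,
      h.face d ∈ (Finset.univ.filter fun q => f (some q) = c).image some := by
    intro d hd
    rw [mem_faceDarts] at hd
    rw [h.face_of_tri hd.1] at hd ⊢
    exact Finset.mem_image_of_mem _ (Finset.mem_filter.2 ⟨Finset.mem_univ _, hd.2⟩)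
  rw [Finset.card_eq_sum_card_fiberwise mapsTo, Finset.sum_image (by simp),
    Finset.sum_const_nat (m := 3), mul_comm]
  intro q hq
  obtain ⟨⟨d, hd⟩, rfl⟩ := Quotient.exists_rep q
  have hc : f (h.face d) = c := by
    rw [h.face_of_tri hd]
    exact (Finset.mem_filter.1 hq).2
  rw [← h.face_of_tri hd, ← h.card_triangle hd]
  congr 1
  ext d'
  simp only [Finset.mem_filter, mem_faceDarts, h.face_eq_face_iff hd, and_iff_right_iff_imp]
  intro hd'
  rw [(h.face_eq_face_iff hd).2 hd']
  exact ⟨h.tri_of_mem_triangle hd hd', hc⟩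

lemma exists_isMerging (h : IsTriangleMap σ φ tri) {G : B → Prop} [DecidablePred G]
    (hG : ∀ d, G (σ d) ↔ G d) :
    ∃ (C : Type u) (_ : Fintype C) (_ : DecidableEq C) (comp : B → C) (O : C) (t : C → ℕ),
      IsMerging σ φ tri G comp O t := by
  classical
  let Γ := dualGraph h.invol (fun d => mt (hG d).1) h.face
  have two_mul_le (c : Γ.ConnectedComponent) :=
    two_mul_card_supp_le h.invol (fun d => mt (hG d).1) h.face c
  have := Fintype.ofFinite Γ.ConnectedComponent
  refine ⟨Γ.ConnectedComponent, inferInstance, inferInstance,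
    fun d => Γ.connectedComponentMk (h.face d), Γ.connectedComponentMk none,
    fun c => (Finset.univ.filter fun q => Γ.connectedComponentMk (some q) = c).card,
    fun d hd => connectedComponentMk_dualGraph_symm _ _ _ hd, fun d hd => ?_,
    fun d hd => congrArg _ (h.face_of_not_tri hd), h.card_faceDarts_tri _, fun c hc => ?_, ?_,
    fun c hc => ?_⟩
  · exact congrArg _ ((h.face_eq_face_iff hd).2 (by simp [triangle]))
  · have := two_mul_le c
    rwa [card_supp_option, if_neg hc] at this
  · have := two_mul_le (Γ.connectedComponentMk none)
    rw [card_supp_option, if_pos rfl] at this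
    exact Nat.le_of_add_le_add_right this
  · obtain ⟨q, hq, q', hq', hne⟩ := Finset.one_lt_card.1 hc
    simp only [Finset.mem_filter, Finset.mem_univ, true_and] at hq hq'
    obtain ⟨p⟩ := SimpleGraph.ConnectedComponent.exact (hq.trans hq'.symm)
    cases p with
    | nil => exact absurd rfl hne
    | cons hadj _ =>
      obtain ⟨face_ne, d, hGd, face_eq, face_symm⟩ := hadj
      refine ⟨d, hGd, by rw [face_eq, hq], ?_⟩
      rw [← h.face_eq_face_iff (h.tri_of_face_eq_some face_eq), face_eq, face_symm]
      exact face_ne.symm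

end IsTriangleMap

/-- The signed distance from `y` to the interval `[1, 2]`, the discharging weight of a corner of
angle `y * π / 3`. -/
noncomputable def excess (y : ℝ) : ℝ := min (y - 1) 0 + max (y - 2) 0

lemma sub_two_le_excess (y : ℝ) : y - 2 ≤ excess y := by
  unfold excess
  rcases le_total (y - 1) 0 with h | h <;> rcases le_total (y - 2) 0 with h' | h' <;>
    simp only [min_eq_left, min_eq_right, max_eq_left, max_eq_right, h, h'] <;> linarith

lemma excess_le_sub_one (y : ℝ) : excess y ≤ y - 1 := by
  unfold excess
  rcases le_total (y - 1) 0 with h | h <;> rcases le_total (y - 2) 0 with h' | h' <;>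
    simp only [min_eq_left, min_eq_right, max_eq_left, max_eq_right, h, h'] <;> linarith

lemma excess_nonneg {y : ℝ} (hy : 1 ≤ y) : 0 ≤ excess y := by
  rw [excess, min_eq_right (by linarith), zero_add]
  exact le_max_right _ _

lemma excess_nonpos {y : ℝ} (hy : y ≤ 2) : excess y ≤ 0 := by
  rw [excess, max_eq_right (by linarith), add_zero]
  exact min_le_right _ _

lemma excess_of_le_one {y : ℝ} (hy : y ≤ 1) : excess y = y - 1 := by
  rw [excess, min_eq_left (by linarith), max_eq_right (by linarith), add_zero]

lemma excess_of_two_le {y : ℝ} (hy : 2 ≤ y) : excess y = y - 2 := by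
  rw [excess, min_eq_right (by linarith), max_eq_left (by linarith), zero_add]

lemma excess_mono {y y' : ℝ} (h : y ≤ y') : excess y ≤ excess y' := by
  unfold excess
  gcongr

lemma excess_add_excess_three_sub (y : ℝ) : excess y + excess (3 - y) = 0 := by
  rcases le_total y 1 with h | h
  · rw [excess_of_le_one h, excess_of_two_le (by linarith)]
    ring
  rcases le_total 2 y with h' | h'
  · rw [excess_of_two_le h', excess_of_le_one (by linarith)]
    ring
  · exact le_antisymm (add_nonpos (excess_nonpos h') (excess_nonpos (by linarith)))
      (add_nonneg (excess_nonneg h) (excess_nonneg (by linarith)))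

section sum_excess

variable {ι : Type*} (s : Finset ι) (y : ι → ℝ)

lemma sum_sub_two_mul_card_le_sum_excess :
    ∑ i ∈ s, y i - 2 * s.card ≤ ∑ i ∈ s, excess (y i) := by
  calc ∑ i ∈ s, y i - 2 * s.card = ∑ i ∈ s, (y i - 2) := by simp [mul_comm]
    _ ≤ ∑ i ∈ s, excess (y i) := Finset.sum_le_sum fun i _ => sub_two_le_excess _

lemma sum_excess_le_sum_sub_card : ∑ i ∈ s, excess (y i) ≤ ∑ i ∈ s, y i - s.card := by
  calc ∑ i ∈ s, excess (y i) ≤ ∑ i ∈ s, (y i - 1) :=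
        Finset.sum_le_sum fun i _ => excess_le_sub_one _
    _ = ∑ i ∈ s, y i - s.card := by simp

variable {s y}

lemma sum_excess_le_four (hy : ∑ i ∈ s, y i = 6) : ∑ i ∈ s, excess (y i) ≤ 4 := by
  have le_sub := hy ▸ sum_excess_le_sum_sub_card s y
  rcases Nat.lt_or_ge s.card 2 with h2 | h2
  · have card_eq_one : s.card = 1 := by
      have : s ≠ ∅ := by
        rintro rfl
        simp at hy
      have := Finset.card_pos.2 (Finset.nonempty_iff_ne_empty.2 this)
      omega
    obtain ⟨i, rfl⟩ := Finset.card_eq_one.1 card_eq_one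
    rw [Finset.sum_singleton] at hy ⊢
    rw [hy, excess_of_two_le (by norm_num)]
    norm_num
  · have : (2 : ℝ) ≤ s.card := by exact_mod_cast h2
    linarith

lemma sum_excess_nonpos (hy : ∑ i ∈ s, y i ≤ s.card + 1) : ∑ i ∈ s, excess (y i) ≤ 0 := by
  by_cases! h : ∃ i ∈ s, 2 < y i
  · obtain ⟨i, hi, two_lt⟩ := h
    classical
    have rest := sum_excess_le_sum_sub_card (s.erase i) y
    rw [Finset.cast_card_erase_of_mem hi] at rest
    rw [← Finset.add_sum_erase s _ hi] at hy ⊢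
    rw [excess_of_two_le two_lt.le]
    linarith
  · exact Finset.sum_nonpos fun i hi => excess_nonpos (h i hi)

lemma sum_excess_nonneg (hy : 2 * s.card - 1 ≤ ∑ i ∈ s, y i) : 0 ≤ ∑ i ∈ s, excess (y i) := by
  by_cases! h : ∃ i ∈ s, y i < 1
  · obtain ⟨i, hi, lt_one⟩ := h
    classical
    have rest := sum_sub_two_mul_card_le_sum_excess (s.erase i) y
    rw [Finset.cast_card_erase_of_mem hi] at rest
    rw [← Finset.add_sum_erase s _ hi] at hy ⊢
    rw [excess_of_le_one lt_one.le]
    linarith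
  · exact Finset.sum_nonneg fun i hi => excess_nonneg (h i hi)

end sum_excess

/-- The sum of `a` over the three darts of the triangle of `d`. -/
def triSum {B : Type*} (φ : B → B) (a : B → ℝ) (d : B) : ℝ := a d + a (φ d) + a (φ (φ d))

/-- Angles `x d`, in units of `π / 3`, from a dart to the next dart around its initial vertex
`src d`, in a triangulation containing the unit edges `G`. -/
structure IsAngleMap {B V : Type*} [Fintype B] [DecidableEq V] (σ φ : B → B) (tri G : B → Prop)
    (src : B → V) (x : B → ℝ) : Prop extends IsTriangleMap σ φ tri where
  symm_iff : ∀ d, G (σ d) ↔ G d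
  src_next : ∀ d, tri d → src (φ d) = src (σ d)
  src_ne : ∀ d, src (σ d) ≠ src d
  nonneg : ∀ d, 0 ≤ x d
  sum_tri : ∀ d, tri d → triSum φ x d = 3
  outer : ∀ d, ¬tri d → 3 ≤ x d
  sum_src : ∀ v, ∑ d with src d = v, x d = 6
  isosceles : ∀ d, tri d → G (φ d) → G (φ (φ d)) → x d = x (φ d)
  rhombus : ∀ d, tri d → G (φ d) → G (φ (φ d)) → tri (σ d) → G (φ (σ d)) → G (φ (φ (σ d))) →
    x d = x (σ d)

/-- An assignment to every dart of the dart of `G` that starts the corner of `G` containing it: a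
dart at the same vertex and in the same merged face. -/
structure IsCornerMap {B C V : Type*} (G : B → Prop) (src : B → V) (comp : B → C) (ψ : B → B) :
    Prop where
  mem : ∀ d, G (ψ d)
  src_eq : ∀ d, src (ψ d) = src d
  comp_eq : ∀ d, comp (ψ d) = comp d
  self : ∀ d, G d → ψ d = d

/-- The angle of the corner of `G` at the dart `d`. -/
def cornerAngle {B : Type*} [Fintype B] [DecidableEq B] (ψ : B → B) (x : B → ℝ) (d : B) : ℝ :=
  ∑ d' with ψ d' = d, x d'

section faceDarts

variable {B C : Type*} [Fintype B] [DecidableEq C] (comp : B → C)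

lemma sum_faceDarts_add_sum_faceDarts_not {M : Type*} [AddCommMonoid M] (P : B → Prop)
    [DecidablePred P] (a : B → M) (c : C) :
    ∑ d ∈ faceDarts comp P c, a d + ∑ d ∈ faceDarts comp (fun d => ¬P d) c, a d =
      ∑ d with comp d = c, a d := by
  rw [← Finset.sum_filter_add_sum_filter_not (Finset.univ.filter fun d => comp d = c) P,
    Finset.filter_filter, Finset.filter_filter]
  simp only [faceDarts, and_comm]

lemma card_faceDarts_add_card_faceDarts_not (P : B → Prop) [DecidablePred P] (c : C) :
    (faceDarts comp P c).card + (faceDarts comp (fun d => ¬P d) c).card =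
      (Finset.univ.filter fun d => comp d = c).card := by
  simp only [Finset.card_eq_sum_ones, sum_faceDarts_add_sum_faceDarts_not]

lemma sum_sum_faceDarts {M : Type*} [AddCommMonoid M] [Fintype C] (P : B → Prop)
    [DecidablePred P] (a : B → M) : ∑ c, ∑ d ∈ faceDarts comp P c, a d = ∑ d with P d, a d := by
  rw [← Finset.sum_fiberwise (Finset.univ.filter P) comp]
  simp only [faceDarts, Finset.filter_filter]

lemma sum_cornerAngle [DecidableEq B] {G : B → Prop} [DecidablePred G] {ψ : B → B}
    (mem : ∀ d, G (ψ d)) (comp_eq : ∀ d, comp (ψ d) = comp d) (x : B → ℝ) (c : C) :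
    ∑ d ∈ faceDarts comp G c, cornerAngle ψ x d = ∑ d with comp d = c, x d := by
  rw [← Finset.sum_fiberwise_of_maps_to (s := Finset.univ.filter fun d => comp d = c)
    (t := faceDarts comp G c) (g := ψ)]
  · refine Finset.sum_congr rfl fun d hd => Finset.sum_congr ?_ fun _ _ => rfl
    ext d'
    simp only [Finset.mem_filter, Finset.mem_univ, true_and, iff_and_self]
    rintro rfl
    rw [← comp_eq]
    exact (mem_faceDarts.1 hd).2
  · intro d hd
    exact mem_faceDarts.2 ⟨mem d, (comp_eq d).trans (Finset.mem_filter.1 hd).2⟩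

end faceDarts

section merging

variable {B C : Type*} [Fintype B] [DecidableEq B] [DecidableEq C] {σ φ : B → B} {tri G : B → Prop}
  [DecidablePred tri] [DecidablePred G] {comp : B → C} {O : C} {t : C → ℕ}

namespace IsMerging

lemma tri_of_comp_ne (hM : IsMerging σ φ tri G comp O t) {d : B} (h : comp d ≠ O) : tri d :=
  not_imp_comm.1 (hM.comp_outer d) h

lemma filter_comp_eq (hM : IsMerging σ φ tri G comp O t) {c : C} (hc : c ≠ O) :
    (Finset.univ.filter fun d => comp d = c) = faceDarts comp tri c := by
  ext d
  simp only [Finset.mem_filter, Finset.mem_univ, mem_faceDarts, true_and, iff_and_self]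
  rintro rfl
  exact hM.tri_of_comp_ne hc

lemma three_mul_eq (hM : IsMerging σ φ tri G comp O t) {c : C} (hc : c ≠ O) :
    3 * t c = (faceDarts comp G c).card + (faceDarts comp (fun d => ¬G d) c).card := by
  rw [card_faceDarts_add_card_faceDarts_not, hM.filter_comp_eq hc, hM.card_tri]

lemma next_mem_faceDarts (hT : IsTriangleMap σ φ tri) (hM : IsMerging σ φ tri G comp O t) {c : C}
    {d : B} (hd : d ∈ faceDarts comp tri c) : φ d ∈ faceDarts comp tri c := by
  rw [mem_faceDarts] at hd ⊢
  exact ⟨hT.tri_next d hd.1, (hM.comp_next d hd.1).trans hd.2⟩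

lemma sum_next (hT : IsTriangleMap σ φ tri) (hM : IsMerging σ φ tri G comp O t) (a : B → ℝ)
    (c : C) : ∑ d ∈ faceDarts comp tri c, a (φ d) = ∑ d ∈ faceDarts comp tri c, a d := by
  have next_three : ∀ d ∈ faceDarts comp tri c, φ (φ (φ d)) = d := fun d hd =>
    hT.next_three d (mem_faceDarts.1 hd).1
  exact Finset.sum_nbij' φ (fun d => φ (φ d)) (fun d => hM.next_mem_faceDarts hT)
    (fun d hd => hM.next_mem_faceDarts hT (hM.next_mem_faceDarts hT hd)) next_three next_three
    fun _ _ => rfl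

lemma sum_triSum (hT : IsTriangleMap σ φ tri) (hM : IsMerging σ φ tri G comp O t) (a : B → ℝ)
    (c : C) :
    ∑ d ∈ faceDarts comp tri c, triSum φ a d = 3 * ∑ d ∈ faceDarts comp tri c, a d := by
  simp only [triSum, Finset.sum_add_distrib]
  rw [hM.sum_next hT (fun d => a (φ d)), hM.sum_next hT a]
  ring

lemma symm_mem_faceDarts_not (hG : ∀ d, G (σ d) ↔ G d) (hM : IsMerging σ φ tri G comp O t) {c : C}
    {d : B} (hd : d ∈ faceDarts comp (fun d => ¬G d) c) :
    σ d ∈ faceDarts comp (fun d => ¬G d) c := by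
  rw [mem_faceDarts] at hd ⊢
  exact ⟨mt (hG d).1 hd.1, (hM.comp_symm d hd.1).trans hd.2⟩

lemma even_card_faceDarts_not (hT : IsTriangleMap σ φ tri) (hG : ∀ d, G (σ d) ↔ G d)
    (hM : IsMerging σ φ tri G comp O t) (c : C) :
    Even (faceDarts comp (fun d => ¬G d) c).card := by
  rw [← ZMod.natCast_eq_zero_iff_even, Finset.cast_card]
  exact Finset.sum_involution (fun d _ => σ d) (fun _ _ => by decide) (fun d _ _ => hT.ne_self d)
    (fun d hd => hM.symm_mem_faceDarts_not hG hd) fun d _ => hT.invol d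

end IsMerging

end merging

namespace IsAngleMap

variable {B V : Type*} [Fintype B] [DecidableEq V] {σ φ ψ : B → B} {tri G : B → Prop}
  {src : B → V} {x : B → ℝ} {d : B}

lemma src_ne_src_next (hA : IsAngleMap σ φ tri G src x) (hd : tri d) : src d ≠ src (φ d) := by
  rw [hA.src_next d hd]
  exact (hA.src_ne d).symm

lemma src_next_next_ne_src (hA : IsAngleMap σ φ tri G src x) (hd : tri d) :
    src (φ (φ d)) ≠ src d := by
  have ne := hA.src_ne_src_next (hA.tri_next _ (hA.tri_next d hd))
  rwa [hA.next_three d hd] at ne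

lemma eq_one_of_equilateral (hA : IsAngleMap σ φ tri G src x) (hd : tri d) (h₀ : G d)
    (h₁ : G (φ d)) (h₂ : G (φ (φ d))) : x d = 1 := by
  have eq₁ := hA.isosceles d hd h₁ h₂
  have eq₂ := hA.isosceles _ (hA.tri_next d hd) h₂ (by rwa [hA.next_three d hd])
  have sum := hA.sum_tri d hd
  rw [triSum] at sum
  linarith

lemma sum_le_cornerAngle [DecidableEq B] (hA : IsAngleMap σ φ tri G src x) (s : Finset B)
    (hs : ∀ d' ∈ s, ψ d' = d) : ∑ d' ∈ s, x d' ≤ cornerAngle ψ x d :=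
  Finset.sum_le_sum_of_subset_of_nonneg (fun d' hd' => by simpa using hs d' hd')
    fun _ _ _ => hA.nonneg _

lemma le_cornerAngle [DecidableEq B] (hA : IsAngleMap σ φ tri G src x) (hd : ψ d = d) :
    x d ≤ cornerAngle ψ x d := by
  simpa using hA.sum_le_cornerAngle {d} (by simpa using hd)

end IsAngleMap

namespace IsTriangleMap

variable {B : Type*} [DecidableEq B] {σ φ : B → B} {tri : B → Prop} {d : B}

lemma disjoint_triangle (h : IsTriangleMap σ φ tri) {d' : B} (hd : tri d) (hd' : tri d')
    (hne : d' ∉ triangle φ d) : Disjoint (triangle φ d) (triangle φ d') := by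
  refine Finset.disjoint_left.2 fun b hb hb' => hne ?_
  rw [← h.triangle_eq_of_mem hd hb, h.triangle_eq_of_mem hd' hb']
  exact Finset.mem_insert_self _ _

lemma triangle_erase (h : IsTriangleMap σ φ tri) (hd : tri d) :
    (triangle φ d).erase d = {φ d, φ (φ d)} := by
  refine Finset.erase_insert fun hmem => ?_
  have card_le : (triangle φ d).card ≤ 2 := by
    rw [triangle, Finset.insert_eq_of_mem hmem]
    exact Finset.card_le_two
  rw [h.card_triangle hd] at card_le
  omega

end IsTriangleMap

section corners

variable {B C V : Type*} [Fintype B] [DecidableEq B] [DecidableEq C] {σ φ ψ : B → B}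
  {tri G : B → Prop} [DecidablePred tri] [DecidablePred G] {comp : B → C} {O c : C} {t : C → ℕ}
  {src : B → V} {x : B → ℝ} {d : B}

namespace IsMerging

lemma triangle_subset_faceDarts (hM : IsMerging σ φ tri G comp O t) (hT : IsTriangleMap σ φ tri)
    (hd : d ∈ faceDarts comp tri c) : triangle φ d ⊆ faceDarts comp tri c := by
  have next_mem := hM.next_mem_faceDarts hT hd
  simp only [triangle, Finset.insert_subset_iff, Finset.singleton_subset_iff]
  exact ⟨hd, next_mem, hM.next_mem_faceDarts hT next_mem⟩

lemma exists_rhombus (hM : IsMerging σ φ tri G comp O t) (hT : IsTriangleMap σ φ tri)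
    (hG : ∀ d, G (σ d) ↔ G d) (hc : c ≠ O) (ht : t c = 2) (hk : (faceDarts comp G c).card = 4) :
    ∃ d ∈ faceDarts comp tri c, σ d ∈ faceDarts comp tri c ∧
      Disjoint (triangle φ d) (triangle φ (σ d)) ∧
      faceDarts comp G c = {φ d, φ (φ d)} ∪ {φ (σ d), φ (φ (σ d))} := by
  obtain ⟨d, hGd, hd, hne⟩ := hM.exists_symm c ht.ge
  have mem_not : d ∈ faceDarts comp (fun d => ¬G d) c := mem_faceDarts.2 ⟨hGd, hd⟩
  have symm_mem_not := hM.symm_mem_faceDarts_not hG mem_not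
  have htri : ∀ b, comp b = c → tri b := fun b hb => hM.tri_of_comp_ne (hb ▸ hc)
  have hd' : comp (σ d) = c := (mem_faceDarts.1 symm_mem_not).2
  have disjoint := hT.disjoint_triangle (htri d hd) (htri _ hd') hne
  have faceDarts_not_eq : {d, σ d} = faceDarts comp (fun d => ¬G d) c := by
    refine Finset.eq_of_subset_of_card_le
      (Finset.insert_subset mem_not (Finset.singleton_subset_iff.2 symm_mem_not)) ?_
    have card_eq := hM.three_mul_eq hc
    rw [Finset.card_pair (hT.ne_self d).symm]
    omega
  have mem : d ∈ faceDarts comp tri c := mem_faceDarts.2 ⟨htri d hd, hd⟩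
  have symm_mem : σ d ∈ faceDarts comp tri c := mem_faceDarts.2 ⟨htri _ hd', hd'⟩
  have faceDarts_tri_eq : triangle φ d ∪ triangle φ (σ d) = faceDarts comp tri c := by
    refine Finset.eq_of_subset_of_card_le (Finset.union_subset
      (hM.triangle_subset_faceDarts hT mem) (hM.triangle_subset_faceDarts hT symm_mem)) ?_
    rw [hM.card_tri, ht, Finset.card_union_of_disjoint disjoint, hT.card_triangle (htri d hd),
      hT.card_triangle (htri _ hd')]
  refine ⟨d, mem, symm_mem, disjoint, ?_⟩
  rw [← hT.triangle_erase (htri d hd), ← hT.triangle_erase (htri _ hd')]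
  ext b
  have mem_tri := Finset.ext_iff.1 faceDarts_tri_eq b
  have mem_not := Finset.ext_iff.1 faceDarts_not_eq b
  have ne_symm : b ∈ triangle φ d → b ≠ σ d := fun hb h => hne (h ▸ hb)
  have ne_self : b ∈ triangle φ (σ d) → b ≠ d := fun hb h =>
    Finset.disjoint_left.1 disjoint (Finset.mem_insert_self _ _) (h ▸ hb)
  have := htri b
  simp only [Finset.mem_union, Finset.mem_erase, Finset.mem_insert, Finset.mem_singleton,
    mem_faceDarts] at mem_tri mem_not ⊢
  tauto

lemma sum_faceDarts_tri [DecidableEq V] (hM : IsMerging σ φ tri G comp O t)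
    (hA : IsAngleMap σ φ tri G src x) (c : C) : ∑ d ∈ faceDarts comp tri c, x d = 3 * t c := by
  have sum_triSum_eq : ∑ d ∈ faceDarts comp tri c, triSum φ x d =
      ∑ _ ∈ faceDarts comp tri c, (3 : ℝ) :=
    Finset.sum_congr rfl fun d hd => hA.sum_tri d (mem_faceDarts.1 hd).1
  rw [hM.sum_triSum hA.toIsTriangleMap, Finset.sum_const, hM.card_tri, nsmul_eq_mul,
    Nat.cast_mul, Nat.cast_ofNat] at sum_triSum_eq
  linarith

lemma one_le_cornerAngle [DecidableEq V] (hM : IsMerging σ φ tri G comp O t)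
    (hA : IsAngleMap σ φ tri G src x) (self : ∀ d, G d → ψ d = d) (hc : c ≠ O)
    (hempty : faceDarts comp (fun d => ¬G d) c = ∅) (hd : comp d = c) : 1 ≤ cornerAngle ψ x d := by
  have mem_G (b : B) (hb : comp b = c) : G b := by
    by_contra hG
    exact Finset.notMem_empty b (hempty ▸ mem_faceDarts.2 ⟨hG, hb⟩)
  have mem_tri (b : B) (hb : comp b = c) : tri b := hM.tri_of_comp_ne (hb ▸ hc)
  have hd₁ := (hM.comp_next d (mem_tri d hd)).trans hd
  have hd₂ := (hM.comp_next _ (mem_tri _ hd₁)).trans hd₁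
  rw [← hA.eq_one_of_equilateral (mem_tri d hd) (mem_G _ hd) (mem_G _ hd₁) (mem_G _ hd₂)]
  exact hA.le_cornerAngle (self d (mem_G d hd))

end IsMerging

namespace IsAngleMap

variable [DecidableEq V]

lemma corner_symm (hA : IsAngleMap σ φ tri G src x) (hψ : IsCornerMap G src comp ψ)
    (hd : tri d) (hd' : σ d ∈ faceDarts comp tri c)
    (hc : faceDarts comp G c = {φ d, φ (φ d)} ∪ {φ (σ d), φ (φ (σ d))}) :
    ψ (σ d) = φ d := by
  obtain ⟨hd', hcomp⟩ := mem_faceDarts.1 hd'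
  have src_eq := hψ.src_eq (σ d)
  have mem : ψ (σ d) ∈ faceDarts comp G c :=
    mem_faceDarts.2 ⟨hψ.mem _, (hψ.comp_eq _).trans hcomp⟩
  simp only [hc, Finset.mem_union, Finset.mem_insert, Finset.mem_singleton, or_assoc] at mem
  rcases mem with h | h | h | h <;> rw [h] at src_eq
  · exact h
  · rw [← hA.src_next d hd] at src_eq
    exact absurd src_eq.symm (hA.src_ne_src_next (hA.tri_next d hd))
  · exact absurd src_eq.symm (hA.src_ne_src_next hd')
  · exact absurd src_eq (hA.src_next_next_ne_src hd')

-- The corner of `G` at `φ d` contains `φ d` and `σ d`, with angles of sum `3 - x (φ (φ d))`.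
lemma excess_add_excess_nonneg (hA : IsAngleMap σ φ tri G src x) (hψ : IsCornerMap G src comp ψ)
    (hd : tri d) (hd' : σ d ∈ faceDarts comp tri c) (hne : φ d ≠ σ d)
    (hc : faceDarts comp G c = {φ d, φ (φ d)} ∪ {φ (σ d), φ (φ (σ d))}) :
    0 ≤ excess (cornerAngle ψ x (φ d)) + excess (cornerAngle ψ x (φ (φ d))) := by
  have corner_eq := hA.corner_symm hψ hd hd' hc
  have mem_G : ∀ b ∈ ({φ d, φ (φ d)} ∪ {φ (σ d), φ (φ (σ d))} : Finset B), G b := fun b hb =>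
    (mem_faceDarts.1 (hc ▸ hb)).1
  have hG₁ : G (φ d) := mem_G _ (by simp)
  have hG₂ : G (φ (φ d)) := mem_G _ (by simp)
  have le₁ : x (φ d) + x (σ d) ≤ cornerAngle ψ x (φ d) := by
    rw [← Finset.sum_pair hne]
    refine hA.sum_le_cornerAngle _ fun b hb => ?_
    simp only [Finset.mem_insert, Finset.mem_singleton] at hb
    rcases hb with rfl | rfl
    exacts [hψ.self _ hG₁, corner_eq]
  have le₂ := hA.le_cornerAngle (ψ := ψ) (hψ.self _ hG₂)
  have rhombus := hA.rhombus d hd hG₁ hG₂ (mem_faceDarts.1 hd').1 (mem_G _ (by simp))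
    (mem_G _ (by simp))
  have sum_eq := hA.sum_tri d hd
  rw [triSum] at sum_eq
  have excess_le₁ := excess_mono le₁
  rw [show x (φ d) + x (σ d) = 3 - x (φ (φ d)) by linarith] at excess_le₁
  linarith [excess_mono le₂, excess_add_excess_three_sub (x (φ (φ d)))]

end IsAngleMap

namespace IsMerging

variable [DecidableEq V]

lemma sum_excess_rhombus (hM : IsMerging σ φ tri G comp O t) (hA : IsAngleMap σ φ tri G src x)
    (hψ : IsCornerMap G src comp ψ) (hc : c ≠ O) (ht : t c = 2)
    (hk : (faceDarts comp G c).card = 4) :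
    0 ≤ ∑ d ∈ faceDarts comp G c, excess (cornerAngle ψ x d) := by
  have hT := hA.toIsTriangleMap
  obtain ⟨d, mem, symm_mem, disjoint, eq_union⟩ := hM.exists_rhombus hT hA.symm_iff hc ht hk
  have hd := (mem_faceDarts.1 mem).1
  have hd' := (mem_faceDarts.1 symm_mem).1
  have next_ne {b b' : B} (h : Disjoint (triangle φ b) (triangle φ b')) : φ b ≠ b' := fun h' =>
    Finset.disjoint_left.1 h (by simp [triangle] : φ b ∈ _) (by simp [triangle, h'])
  have nonneg := hA.excess_add_excess_nonneg hψ hd symm_mem (next_ne disjoint) eq_union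
  have nonneg' := hA.excess_add_excess_nonneg (d := σ d) hψ hd' (by rwa [hT.invol])
    (by rw [hT.invol]; exact next_ne disjoint.symm) (by rw [hT.invol, eq_union, Finset.union_comm])
  have pair_disjoint : Disjoint ({φ d, φ (φ d)} : Finset B) {φ (σ d), φ (φ (σ d))} :=
    disjoint.mono (Finset.subset_insert _ _) (Finset.subset_insert _ _)
  rw [eq_union, Finset.sum_union pair_disjoint,
    Finset.sum_pair (hT.next_ne _ (hT.tri_next d hd)).symm,
    Finset.sum_pair (hT.next_ne _ (hT.tri_next _ hd')).symm]
  exact add_nonneg nonneg nonneg'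

lemma sum_excess_inner (hM : IsMerging σ φ tri G comp O t) (hA : IsAngleMap σ φ tri G src x)
    (hψ : IsCornerMap G src comp ψ) (hc : c ≠ O) :
    0 ≤ ∑ d ∈ faceDarts comp G c, excess (cornerAngle ψ x d) := by
  have card_eq := hM.three_mul_eq hc
  have inner := hM.inner c hc
  obtain ⟨j, hj⟩ := hM.even_card_faceDarts_not hA.toIsTriangleMap hA.symm_iff c
  by_cases hk : 2 * (faceDarts comp G c).card ≤ 3 * t c + 1
  · refine sum_excess_nonneg ?_
    rw [sum_cornerAngle comp hψ.mem hψ.comp_eq, hM.filter_comp_eq hc, hM.sum_faceDarts_tri hA,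
      sub_le_iff_le_add]
    exact_mod_cast hk
  have exceptional : (t c = 2 ∧ (faceDarts comp G c).card = 4) ∨
      (faceDarts comp (fun d => ¬G d) c).card = 0 := by
    omega
  rcases exceptional with ⟨ht, hcard⟩ | hempty
  · exact hM.sum_excess_rhombus hA hψ hc ht hcard
  · exact Finset.sum_nonneg fun d hd => excess_nonneg <| hM.one_le_cornerAngle hA hψ.self hc
      (Finset.card_eq_zero.1 hempty) (mem_faceDarts.1 hd).2

lemma three_mul_card_le_sum_outer (hM : IsMerging σ φ tri G comp O t)
    (hA : IsAngleMap σ φ tri G src x) :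
    3 * ((faceDarts comp G O).card : ℝ) ≤ ∑ d with comp d = O, x d := by
  have card_le : (faceDarts comp G O).card ≤
      t O + (faceDarts comp (fun d => ¬tri d) O).card := by
    have split_G := card_faceDarts_add_card_faceDarts_not comp G O
    have split_tri := card_faceDarts_add_card_faceDarts_not comp tri O
    have outer := hM.outer
    rw [hM.card_tri] at split_tri
    omega
  have le_sum : (faceDarts comp (fun d => ¬tri d) O).card • (3 : ℝ) ≤
      ∑ d ∈ faceDarts comp (fun d => ¬tri d) O, x d :=
    Finset.card_nsmul_le_sum _ _ _ fun d hd => hA.outer d (mem_faceDarts.1 hd).1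
  calc 3 * ((faceDarts comp G O).card : ℝ)
      ≤ 3 * (t O + (faceDarts comp (fun d => ¬tri d) O).card) := by
        gcongr
        exact_mod_cast card_le
    _ ≤ ∑ d ∈ faceDarts comp tri O, x d + ∑ d ∈ faceDarts comp (fun d => ¬tri d) O, x d := by
        rw [hM.sum_faceDarts_tri hA, mul_add]
        gcongr
        simpa [mul_comm] using le_sum
    _ = ∑ d with comp d = O, x d := sum_faceDarts_add_sum_faceDarts_not comp tri x O

lemma card_outer_le [Finite C] [Fintype V] (hM : IsMerging σ φ tri G comp O t)
    (hA : IsAngleMap σ φ tri G src x) (hψ : IsCornerMap G src comp ψ) :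
    (faceDarts comp G O).card ≤
      4 * (Finset.univ.filter fun v => (faceDarts src G v).card ≤ 4).card := by
  cases nonempty_fintype C
  have vertex (v : V) : ∑ d ∈ faceDarts src G v, excess (cornerAngle ψ x d) ≤
      if (faceDarts src G v).card ≤ 4 then 4 else 0 := by
    have sum_eq : ∑ d ∈ faceDarts src G v, cornerAngle ψ x d = 6 := by
      rw [sum_cornerAngle src hψ.mem hψ.src_eq, hA.sum_src]
    split_ifs with h
    · exact sum_excess_le_four sum_eq
    · refine sum_excess_nonpos ?_
      rw [sum_eq]
      exact_mod_cast show 6 ≤ (faceDarts src G v).card + 1 by omega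
  have outer := sum_sub_two_mul_card_le_sum_excess (faceDarts comp G O) (cornerAngle ψ x)
  rw [sum_cornerAngle comp hψ.mem hψ.comp_eq] at outer
  have key : ((faceDarts comp G O).card : ℝ) ≤
      4 * (Finset.univ.filter fun v => (faceDarts src G v).card ≤ 4).card := by
    calc ((faceDarts comp G O).card : ℝ)
        ≤ ∑ d ∈ faceDarts comp G O, excess (cornerAngle ψ x d) := by
          linarith [hM.three_mul_card_le_sum_outer hA]
      _ ≤ ∑ c, ∑ d ∈ faceDarts comp G c, excess (cornerAngle ψ x d) := by
          rw [← Finset.add_sum_erase _ _ (Finset.mem_univ O)]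
          exact le_add_of_nonneg_right <| Finset.sum_nonneg fun c hc =>
            hM.sum_excess_inner hA hψ (Finset.ne_of_mem_erase hc)
      _ = ∑ v, ∑ d ∈ faceDarts src G v, excess (cornerAngle ψ x d) := by
          rw [sum_sum_faceDarts, sum_sum_faceDarts]
      _ ≤ ∑ v, if (faceDarts src G v).card ≤ 4 then (4 : ℝ) else 0 :=
          Finset.sum_le_sum fun v _ => vertex v
      _ = 4 * (Finset.univ.filter fun v => (faceDarts src G v).card ≤ 4).card := by
          rw [← Finset.sum_filter, Finset.sum_const, nsmul_eq_mul, mul_comm]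
  exact_mod_cast key

end IsMerging

end corners

/-- The inner merged faces that consist of a single triangle with all its sides in `G`. -/
def unitTriangles {B C : Type*} [Fintype B] [DecidableEq B] [Fintype C] [DecidableEq C]
    (G : B → Prop) [DecidablePred G] (comp : B → C) (O : C) (t : C → ℕ) : Finset C :=
  {c | c ≠ O ∧ t c = 1 ∧ faceDarts comp (fun d => ¬G d) c = ∅}

section unitTriangles

variable {B C V : Type*} [Fintype B] [DecidableEq B] [Fintype C] [DecidableEq C] [DecidableEq V]
  {σ φ : B → B} {tri G : B → Prop} [DecidablePred tri] [DecidablePred G] {comp : B → C} {O c : C}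
  {t : C → ℕ} {src : B → V} {x : B → ℝ}

lemma mem_unitTriangles : c ∈ unitTriangles G comp O t ↔
    c ≠ O ∧ t c = 1 ∧ faceDarts comp (fun d => ¬G d) c = ∅ := by
  simp only [unitTriangles, Finset.mem_filter, Finset.mem_univ, true_and]

namespace IsMerging

lemma card_faceDarts_le (hM : IsMerging σ φ tri G comp O t) (hT : IsTriangleMap σ φ tri)
    (hG : ∀ d, G (σ d) ↔ G d) (hc : c ≠ O) :
    (faceDarts comp G c).card ≤ 2 * t c + if c ∈ unitTriangles G comp O t then 1 else 0 := by
  have card_eq := hM.three_mul_eq hc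
  have inner := hM.inner c hc
  obtain ⟨j, hj⟩ := hM.even_card_faceDarts_not hT hG c
  split_ifs with h
  · omega
  · rw [mem_unitTriangles, ← Finset.card_eq_zero] at h
    have : ¬(t c = 1 ∧ (faceDarts comp (fun d => ¬G d) c).card = 0) := fun h' => h ⟨hc, h'⟩
    omega

lemma card_darts_le [Fintype V] (hM : IsMerging σ φ tri G comp O t)
    (hA : IsAngleMap σ φ tri G src x) :
    (Finset.univ.filter G).card + (faceDarts comp G O).card ≤
      4 * Fintype.card V + (unitTriangles G comp O t).card := by
  have face (c : C) : ((faceDarts comp G c).card : ℝ) +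
      (if c = O then ((faceDarts comp G O).card : ℝ) else 0) ≤
      2 / 3 * ∑ d with comp d = c, x d + if c ∈ unitTriangles G comp O t then 1 else 0 := by
    by_cases hc : c = O
    · subst hc
      have not_mem : c ∉ unitTriangles G comp c t := fun h => (mem_unitTriangles.1 h).1 rfl
      rw [if_pos rfl, if_neg not_mem]
      linarith [hM.three_mul_card_le_sum_outer hA]
    · rw [if_neg hc, add_zero, hM.filter_comp_eq hc, hM.sum_faceDarts_tri hA,
        show 2 / 3 * (3 * (t c : ℝ)) = 2 * t c by ring]
      exact_mod_cast hM.card_faceDarts_le hA.toIsTriangleMap hA.symm_iff hc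
  have sum_card : ∑ c, ((faceDarts comp G c).card : ℝ) = (Finset.univ.filter G).card := by
    simpa using sum_sum_faceDarts comp G fun _ => (1 : ℝ)
  have sum_angles : ∑ d, x d = 6 * Fintype.card V := by
    rw [← Finset.sum_fiberwise Finset.univ src]
    simp [hA.sum_src, mul_comm]
  have total := Finset.sum_le_sum fun c (_ : c ∈ Finset.univ) => face c
  rw [Finset.sum_add_distrib, sum_card, Finset.sum_ite_eq' Finset.univ O,
    if_pos (Finset.mem_univ O), Finset.sum_add_distrib, ← Finset.mul_sum, Finset.sum_fiberwise,
    sum_angles, Finset.sum_boole, Finset.filter_univ_mem] at total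
  have key : ((Finset.univ.filter G).card : ℝ) + (faceDarts comp G O).card ≤
      4 * Fintype.card V + (unitTriangles G comp O t).card := by linarith
  exact_mod_cast key

end IsMerging

end unitTriangles

section boundary

variable {B C V : Type*} {σ φ : B → B} {tri G : B → Prop} {src : B → V} {x a : B → ℝ}

lemma IsTriangleMap.sum_eq_zero_of_symm (hT : IsTriangleMap σ φ tri) (ha : ∀ d, a (σ d) = -a d)
    {s : Finset B} (hs : ∀ d ∈ s, σ d ∈ s) : ∑ d ∈ s, a d = 0 :=
  Finset.sum_involution (fun d _ => σ d) (fun d _ => by rw [ha, add_neg_cancel])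
    (fun d _ _ => hT.ne_self d) hs fun d _ => hT.invol d

variable [Fintype B] [DecidableEq V]

lemma IsAngleMap.triSum_sub_eq_zero (hA : IsAngleMap σ φ tri G src x) (f : V → ℝ) {d : B}
    (hd : tri d) : triSum φ (fun d => f (src (σ d)) - f (src d)) d = 0 := by
  have next₁ := hA.src_next d hd
  have next₂ := hA.src_next _ (hA.tri_next d hd)
  have next₃ := hA.src_next _ (hA.tri_next _ (hA.tri_next d hd))
  rw [hA.next_three d hd] at next₃
  simp only [triSum, ← next₁, ← next₂, ← next₃]
  ring

variable [DecidableEq B] [DecidableEq C] [DecidablePred tri] [DecidablePred G] {comp : B → C}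
  {O c : C} {t : C → ℕ}

namespace IsMerging

lemma sum_faceDarts_inner (hM : IsMerging σ φ tri G comp O t) (hT : IsTriangleMap σ φ tri)
    (hG : ∀ d, G (σ d) ↔ G d) (ha : ∀ d, a (σ d) = -a d) (hc : c ≠ O) :
    ∑ d ∈ faceDarts comp G c, a d = 1 / 3 * ∑ d ∈ faceDarts comp tri c, triSum φ a d := by
  have sum_not := hT.sum_eq_zero_of_symm ha fun d => hM.symm_mem_faceDarts_not hG (c := c)
  rw [hM.sum_triSum hT, ← hM.filter_comp_eq hc, ← sum_faceDarts_add_sum_faceDarts_not comp G,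
    sum_not]
  ring

-- Every dart of `G` is cancelled by its reverse, so the outer boundary carries minus the rest.
lemma sum_faceDarts_outer [Fintype C] (hM : IsMerging σ φ tri G comp O t)
    (hT : IsTriangleMap σ φ tri) (hG : ∀ d, G (σ d) ↔ G d) (ha : ∀ d, a (σ d) = -a d) :
    ∑ d ∈ faceDarts comp G O, a d =
      -∑ c ∈ Finset.univ.erase O, 1 / 3 * ∑ d ∈ faceDarts comp tri c, triSum φ a d := by
  have total : ∑ c, ∑ d ∈ faceDarts comp G c, a d = 0 := by
    rw [sum_sum_faceDarts]
    exact hT.sum_eq_zero_of_symm ha fun d hd => by simpa [hG] using hd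
  rw [← Finset.add_sum_erase _ _ (Finset.mem_univ O)] at total
  rw [eq_neg_of_add_eq_zero_left total]
  exact congrArg _ <| Finset.sum_congr rfl fun c hc =>
    hM.sum_faceDarts_inner hT hG ha (Finset.ne_of_mem_erase hc)

lemma sum_triSum_unitTriangle [Fintype C] (hM : IsMerging σ φ tri G comp O t)
    (hT : IsTriangleMap σ φ tri) {α : ℝ}
    (hα : ∀ d, tri d → G d → G (φ d) → G (φ (φ d)) → triSum φ a d = α)
    (hc : c ∈ unitTriangles G comp O t) : ∑ d ∈ faceDarts comp tri c, triSum φ a d = 3 * α := by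
  obtain ⟨-, ht, hempty⟩ := mem_unitTriangles.1 hc
  have mem_G (b : B) (hb : b ∈ faceDarts comp tri c) : G b := by
    by_contra hG
    exact Finset.notMem_empty b (hempty ▸ mem_faceDarts.2 ⟨hG, (mem_faceDarts.1 hb).2⟩)
  have eq_const (d : B) (hd : d ∈ faceDarts comp tri c) : triSum φ a d = α := by
    have hd₁ := hM.next_mem_faceDarts hT hd
    exact hα d (mem_faceDarts.1 hd).1 (mem_G d hd) (mem_G _ hd₁)
      (mem_G _ (hM.next_mem_faceDarts hT hd₁))
  rw [Finset.sum_congr rfl eq_const, Finset.sum_const, hM.card_tri, ht, nsmul_eq_mul]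
  norm_num

lemma sum_faceDarts_outer_le [Fintype C] (hM : IsMerging σ φ tri G comp O t)
    (hT : IsTriangleMap σ φ tri) (hG : ∀ d, G (σ d) ↔ G d) (ha : ∀ d, a (σ d) = -a d)
    (hnonneg : ∀ d, tri d → 0 ≤ triSum φ a d) {α : ℝ}
    (hα : ∀ d, tri d → G d → G (φ d) → G (φ (φ d)) → triSum φ a d = α) :
    ∑ d ∈ faceDarts comp G O, a d ≤ -((unitTriangles G comp O t).card * α) := by
  rw [hM.sum_faceDarts_outer hT hG ha, neg_le_neg_iff]
  calc (unitTriangles G comp O t).card * α = ∑ c ∈ unitTriangles G comp O t,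
        1 / 3 * ∑ d ∈ faceDarts comp tri c, triSum φ a d := by
        rw [Finset.sum_congr rfl fun c hc => by rw [hM.sum_triSum_unitTriangle hT hα hc],
          Finset.sum_const, nsmul_eq_mul]
        ring
    _ ≤ _ := Finset.sum_le_sum_of_subset_of_nonneg
        (fun c hc => Finset.mem_erase.2 ⟨(mem_unitTriangles.1 hc).1, Finset.mem_univ c⟩)
        fun c _ _ => mul_nonneg (by norm_num) <| Finset.sum_nonneg fun d hd =>
          hnonneg d (mem_faceDarts.1 hd).1

lemma card_outer_src_eq [Finite C] (hM : IsMerging σ φ tri G comp O t)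
    (hA : IsAngleMap σ φ tri G src x) (v : V) :
    (Finset.univ.filter fun d : faceDarts comp G O => src (σ d) = v).card =
      (Finset.univ.filter fun d : faceDarts comp G O => src d = v).card := by
  cases nonempty_fintype C
  let f : V → ℝ := fun u => if u = v then 1 else 0
  have sum_eq := hM.sum_faceDarts_outer hA.toIsTriangleMap hA.symm_iff
    (a := fun d => f (src (σ d)) - f (src d)) fun d => by rw [hA.invol, neg_sub]
  have sum_zero (c : C) : ∑ d ∈ faceDarts comp tri c,
      triSum φ (fun d => f (src (σ d)) - f (src d)) d = 0 :=
    Finset.sum_eq_zero fun d hd => hA.triSum_sub_eq_zero f (mem_faceDarts.1 hd).1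
  simp only [sum_zero, mul_zero, Finset.sum_const_zero, neg_zero, Finset.sum_sub_distrib] at sum_eq
  rw [sub_eq_zero, ← Finset.sum_coe_sort, ← Finset.sum_coe_sort (faceDarts comp G O),
    Finset.sum_boole, Finset.sum_boole] at sum_eq
  exact_mod_cast sum_eq

lemma exists_perm_outer [Finite C] (hM : IsMerging σ φ tri G comp O t)
    (hA : IsAngleMap σ φ tri G src x) :
    ∃ τ : Equiv.Perm (faceDarts comp G O), ∀ d, src (τ d) = src (σ d) := by
  have equiv (v : V) : {d : faceDarts comp G O // src (σ d) = v} ≃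
      {d : faceDarts comp G O // src d = v} :=
    Fintype.equivOfCardEq <| by
      rw [Fintype.card_subtype, Fintype.card_subtype, hM.card_outer_src_eq hA]
  exact ⟨Equiv.ofFiberEquiv equiv, Equiv.ofFiberEquiv_map equiv⟩

-- The outer boundary runs clockwise, and conjugation turns it into a counterclockwise curve.
lemma card_unitTriangles_mul_lt [Fintype C] (hM : IsMerging σ φ tri G comp O t)
    (hA : IsAngleMap σ φ tri G src x) {z : V → ℂ}
    (hz : ∀ d, G d → ‖z (src (σ d)) - z (src d)‖ = 1)
    (hnonneg : ∀ d, tri d → 0 ≤ triSum φ (fun d => ω (z (src d)) (z (src (σ d)))) d) {α : ℝ}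
    (hα : ∀ d, tri d → G d → G (φ d) → G (φ (φ d)) →
      triSum φ (fun d => ω (z (src d)) (z (src (σ d)))) d = α)
    (hα_pos : 0 < α) (hne : (unitTriangles G comp O t).Nonempty) :
    (unitTriangles G comp O t).card * α < ((faceDarts comp G O).card : ℝ) ^ 2 / (2 * Real.pi) := by
  have sum_le := hM.sum_faceDarts_outer_le hA.toIsTriangleMap hA.symm_iff
    (a := fun d => ω (z (src d)) (z (src (σ d))))
    (fun d => by rw [hA.invol, Orientation.areaForm_swap]) hnonneg hα
  have card_pos : (0 : ℝ) < (unitTriangles G comp O t).card := by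
    exact_mod_cast Finset.card_pos.2 hne
  have outer_nonempty : (faceDarts comp G O).Nonempty := by
    by_contra! hempty
    rw [hempty, Finset.sum_empty, neg_nonneg] at sum_le
    exact absurd sum_le (not_le.2 (mul_pos card_pos hα_pos))
  have := outer_nonempty.to_subtype
  obtain ⟨τ, hτ⟩ := hM.exists_perm_outer hA
  have isoperimetric := sum_areaForm_perm_lt τ (fun d => starRingEnd ℂ (z (src d))) fun d => by
    rw [← map_sub, Complex.norm_conj, hτ]
    exact hz d (mem_faceDarts.1 d.2).1
  have area_eq : ∑ d : faceDarts comp G O, ω (starRingEnd ℂ (z (src d)))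
      (starRingEnd ℂ (z (src (τ d)))) =
      -∑ d ∈ faceDarts comp G O, ω (z (src d)) (z (src (σ d))) := by
    rw [← Finset.sum_coe_sort (faceDarts comp G O), ← Finset.sum_neg_distrib]
    refine Finset.sum_congr rfl fun d _ => ?_
    rw [hτ, areaForm_apply, areaForm_apply]
    simp only [Complex.conj_re, Complex.conj_im]
    ring
  rw [area_eq, Fintype.card_coe] at isoperimetric
  linarith

end IsMerging

end boundary

lemma angle_eq_of_norm_eq {E F : Type*} [NormedAddCommGroup E] [InnerProductSpace ℝ E]
    [NormedAddCommGroup F] [InnerProductSpace ℝ F] {a b : E} {a' b' : F} (ha : ‖a‖ = ‖a'‖)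
    (hb : ‖b‖ = ‖b'‖) (hab : ‖a - b‖ = ‖a' - b'‖) :
    InnerProductGeometry.angle a b = InnerProductGeometry.angle a' b' := by
  unfold InnerProductGeometry.angle
  rw [real_inner_eq_norm_mul_self_add_norm_mul_self_sub_norm_sub_mul_self_div_two,
    real_inner_eq_norm_mul_self_add_norm_mul_self_sub_norm_sub_mul_self_div_two, ha, hb, hab]

/-- The next dart along the face on the left of `d`, for the rotation `N`. -/
def faceNext {V : Type*} {T : SimpleGraph V} (N : Equiv.Perm T.Dart) (d : T.Dart) : T.Dart :=
  N.symm d.symm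

/-- A dart is a side of a triangle on its left if it makes an angle less than `π` with the next
dart around its initial vertex. -/
def IsTri {V : Type*} {T : SimpleGraph V} (z : V → ℂ) (N : Equiv.Perm T.Dart) (d : T.Dart) : Prop :=
  0 < ω (dartDir z d) (dartDir z (N d))

namespace IsRotation

variable {V : Type*} {z : V → ℂ} {T : SimpleGraph V} [Fintype T.Dart] [DecidableEq V]
  {N : Equiv.Perm T.Dart} {d : T.Dart}

lemma faceNext_fst (hN : IsRotation z N) (d : T.Dart) : (faceNext N d).fst = d.snd := by
  rw [← hN.fst, faceNext, Equiv.apply_symm_apply]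
  rfl

lemma ccwAngle_eq (hN : IsRotation z N) (hd : IsTri z N d) :
    ccwAngle (dartDir z d) (dartDir z (N d)) =
      InnerProductGeometry.angle (z d.snd - z d.fst) (z (N d).snd - z d.fst) := by
  rw [ccwAngle_eq_angle hd, hN.dartDir_apply, dartDir]

variable [Finite V]

lemma isTri_faceNext (hT : Maximal (IsPlaneDrawing z) T) (hN : IsRotation z N)
    (hd : IsTri z N d) : IsTri z N (faceNext N d) := by
  rw [IsTri, faceNext, Equiv.apply_symm_apply, (hN.exists_triangle hT d hd).2.2]
  exact hd

lemma faceNext_snd (hT : Maximal (IsPlaneDrawing z) T) (hN : IsRotation z N)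
    (hd : IsTri z N d) : (faceNext N d).snd = (N d).snd := (hN.exists_triangle hT d hd).2.1

lemma faceNext_faceNext_fst (hT : Maximal (IsPlaneDrawing z) T) (hN : IsRotation z N)
    (hd : IsTri z N d) : (faceNext N (faceNext N d)).fst = (N d).snd := by
  rw [hN.faceNext_fst, hN.faceNext_snd hT hd]

lemma faceNext_faceNext_snd (hT : Maximal (IsPlaneDrawing z) T) (hN : IsRotation z N)
    (hd : IsTri z N d) : (faceNext N (faceNext N d)).snd = d.fst := by
  rw [hN.faceNext_snd hT (hN.isTri_faceNext hT hd), faceNext, Equiv.apply_symm_apply]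
  rfl

lemma isTriangleMap (hT : Maximal (IsPlaneDrawing z) T) (hN : IsRotation z N) :
    IsTriangleMap SimpleGraph.Dart.symm (faceNext N) (IsTri z N) where
  invol := SimpleGraph.Dart.symm_symm
  ne_self := SimpleGraph.Dart.symm_ne
  tri_next _ hd := hN.isTri_faceNext hT hd
  next_three d hd := by
    have snd_eq := hN.faceNext_faceNext_snd hT (hN.isTri_faceNext hT hd)
    refine SimpleGraph.Dart.ext _ _ (Prod.ext ?_ (snd_eq.trans (hN.faceNext_fst d)))
    exact (hN.faceNext_fst _).trans (hN.faceNext_faceNext_snd hT hd)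
  next_ne d _ h := by
    have fst_eq := hN.faceNext_fst d
    rw [h] at fst_eq
    exact d.adj.ne fst_eq

lemma ccwAngle_faceNext_eq (hT : Maximal (IsPlaneDrawing z) T) (hN : IsRotation z N)
    (hd : IsTri z N d) :
    ccwAngle (dartDir z (faceNext N d)) (dartDir z (N (faceNext N d))) =
      InnerProductGeometry.angle (z (N d).snd - z d.snd) (z d.fst - z d.snd) := by
  rw [hN.ccwAngle_eq (hN.isTri_faceNext hT hd), hN.faceNext_fst, hN.faceNext_snd hT hd, faceNext,
    Equiv.apply_symm_apply]
  rfl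

lemma triSum_ccwAngle (hT : Maximal (IsPlaneDrawing z) T) (hN : IsRotation z N)
    (hd : IsTri z N d) :
    triSum (faceNext N) (fun d => ccwAngle (dartDir z d) (dartDir z (N d))) d = Real.pi := by
  have apply_faceNext_snd : (N (faceNext N d)).snd = d.fst := by
    rw [faceNext, Equiv.apply_symm_apply]
    rfl
  have angle_sum := EuclideanGeometry.angle_add_angle_add_angle_eq_pi (p₁ := z d.snd)
    (p₂ := z d.fst) (z (N d).snd) fun h => d.adj.ne (hT.prop.injective h)
  simp only [EuclideanGeometry.angle, vsub_eq_sub] at angle_sum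
  rw [triSum, hN.ccwAngle_eq hd, hN.ccwAngle_faceNext_eq hT hd,
    hN.ccwAngle_faceNext_eq hT (hN.isTri_faceNext hT hd), apply_faceNext_snd, hN.faceNext_fst,
    hN.faceNext_snd hT hd, add_right_comm, angle_sum]

variable {G : SimpleGraph V}

lemma ccwAngle_eq_of_isosceles (hT : Maximal (IsPlaneDrawing z) T) (hN : IsRotation z N)
    (hG : ∀ u v, G.Adj u v → ‖z v - z u‖ = 1) (hd : IsTri z N d)
    (h₁ : G.Adj (faceNext N d).fst (faceNext N d).snd)
    (h₂ : G.Adj (faceNext N (faceNext N d)).fst (faceNext N (faceNext N d)).snd) :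
    ccwAngle (dartDir z d) (dartDir z (N d)) =
      ccwAngle (dartDir z (faceNext N d)) (dartDir z (N (faceNext N d))) := by
  rw [hN.faceNext_fst, hN.faceNext_snd hT hd] at h₁
  rw [hN.faceNext_faceNext_fst hT hd, hN.faceNext_faceNext_snd hT hd] at h₂
  rw [hN.ccwAngle_eq hd, hN.ccwAngle_faceNext_eq hT hd,
    InnerProductGeometry.angle_comm (_ - z d.snd)]
  refine angle_eq_of_norm_eq (norm_sub_rev _ _) ?_ ?_
  · rw [hG _ _ h₁, hG _ _ h₂.symm]
  · rw [sub_sub_sub_cancel_right, sub_sub_sub_cancel_right, hG _ _ h₁.symm, hG _ _ h₂]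

lemma ccwAngle_eq_of_rhombus (hT : Maximal (IsPlaneDrawing z) T) (hN : IsRotation z N)
    (hG : ∀ u v, G.Adj u v → ‖z v - z u‖ = 1) (hd : IsTri z N d)
    (h₁ : G.Adj (faceNext N d).fst (faceNext N d).snd)
    (h₂ : G.Adj (faceNext N (faceNext N d)).fst (faceNext N (faceNext N d)).snd)
    (hd' : IsTri z N d.symm) (h₃ : G.Adj (faceNext N d.symm).fst (faceNext N d.symm).snd)
    (h₄ : G.Adj (faceNext N (faceNext N d.symm)).fst (faceNext N (faceNext N d.symm)).snd) :
    ccwAngle (dartDir z d) (dartDir z (N d)) =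
      ccwAngle (dartDir z d.symm) (dartDir z (N d.symm)) := by
  rw [hN.faceNext_fst, hN.faceNext_snd hT hd] at h₁
  rw [hN.faceNext_faceNext_fst hT hd, hN.faceNext_faceNext_snd hT hd] at h₂
  rw [hN.faceNext_fst, hN.faceNext_snd hT hd'] at h₃
  rw [hN.faceNext_faceNext_fst hT hd', hN.faceNext_faceNext_snd hT hd'] at h₄
  rw [hN.ccwAngle_eq hd, hN.ccwAngle_eq hd']
  refine angle_eq_of_norm_eq (norm_sub_rev _ _) ?_ ?_
  · rw [hG _ _ h₂.symm, hG _ _ h₄.symm]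
  · rw [sub_sub_sub_cancel_right, sub_sub_sub_cancel_right, hG _ _ h₁.symm, hG _ _ h₃.symm]

lemma isAngleMap (hT : Maximal (IsPlaneDrawing z) T) (hN : IsRotation z N)
    (hG : ∀ u v, G.Adj u v → ‖z v - z u‖ = 1) (hdart : ∀ v, ∃ d : T.Dart, d.fst = v) :
    IsAngleMap SimpleGraph.Dart.symm (faceNext N) (IsTri z N)
      (fun d : T.Dart => G.Adj d.fst d.snd) (fun d => d.fst)
      (fun d => 3 / Real.pi * ccwAngle (dartDir z d) (dartDir z (N d))) where
  toIsTriangleMap := hN.isTriangleMap hT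
  symm_iff _ := G.adj_comm _ _
  src_next d _ := hN.faceNext_fst d
  src_ne d := d.adj.ne'
  nonneg d := mul_nonneg (by positivity) ccwAngle_pos.le
  sum_tri d hd := by
    have sum_eq := hN.triSum_ccwAngle hT hd
    rw [triSum] at sum_eq ⊢
    rw [← mul_add, ← mul_add, sum_eq, div_mul_cancel₀ _ Real.pi_ne_zero]
  outer d hd := by
    have pi_le := not_lt.1 <| mt (ccwAngle_lt_pi_iff (hT.prop.dartDir_ne_zero d)
      (hT.prop.dartDir_ne_zero (N d))).1 hd
    rw [div_mul_eq_mul_div, le_div_iff₀ Real.pi_pos]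
    gcongr
  sum_src v := by
    obtain ⟨d, rfl⟩ := hdart v
    rw [← Finset.mul_sum, hN.sum d]
    field_simp
    norm_num
  isosceles d hd h₁ h₂ := by rw [hN.ccwAngle_eq_of_isosceles hT hG hd h₁ h₂]
  rhombus d hd h₁ h₂ hd' h₃ h₄ := by rw [hN.ccwAngle_eq_of_rhombus hT hG hd h₁ h₂ hd' h₃ h₄]

lemma triSum_areaForm (hT : Maximal (IsPlaneDrawing z) T) (hN : IsRotation z N)
    (hd : IsTri z N d) :
    triSum (faceNext N) (fun d => ω (z d.fst) (z d.symm.fst)) d =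
      ω (dartDir z d) (dartDir z (N d)) := by
  have symm_fst (d : T.Dart) : d.symm.fst = d.snd := rfl
  simp only [triSum, symm_fst]
  rw [hN.faceNext_faceNext_snd hT hd, hN.faceNext_faceNext_fst hT hd, hN.faceNext_snd hT hd,
    hN.faceNext_fst, hN.dartDir_apply, dartDir]
  simp only [areaForm_apply, Complex.sub_re, Complex.sub_im]
  ring

lemma areaForm_dartDir_of_equilateral (hT : Maximal (IsPlaneDrawing z) T) (hN : IsRotation z N)
    (hG : ∀ u v, G.Adj u v → ‖z v - z u‖ = 1) (hd : IsTri z N d) (h₀ : G.Adj d.fst d.snd)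
    (h₂ : G.Adj (faceNext N (faceNext N d)).fst (faceNext N (faceNext N d)).snd)
    (hangle : 3 / Real.pi * ccwAngle (dartDir z d) (dartDir z (N d)) = 1) :
    ω (dartDir z d) (dartDir z (N d)) = √3 / 2 := by
  rw [hN.faceNext_faceNext_fst hT hd, hN.faceNext_faceNext_snd hT hd] at h₂
  have norm_eq : ‖dartDir z d‖ = 1 := hG _ _ h₀
  have norm_apply_eq : ‖dartDir z (N d)‖ = 1 := by
    rw [hN.dartDir_apply, hG _ _ h₂.symm]
  have angle_eq : ccwAngle (dartDir z d) (dartDir z (N d)) = Real.pi / 3 := by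
    field_simp at hangle ⊢
    linarith
  rw [← norm_mul_sin_ccwAngle, norm_eq, norm_apply_eq, angle_eq, Real.sin_pi_div_three]
  ring

end IsRotation

namespace IsRotation

variable {V : Type*} {z : V → ℂ} {T : SimpleGraph V} [Fintype T.Dart] [DecidableEq V]
  {N : Equiv.Perm T.Dart} [Finite V]

section IsMerging

variable {C : Type*} [DecidableEq C] [DecidablePred (IsTri z N)] {comp : T.Dart → C} {O : C}
  {t : C → ℕ}

lemma comp_apply_eq (hT : Maximal (IsPlaneDrawing z) T) (hN : IsRotation z N) {G : T.Dart → Prop}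
    [DecidablePred G] (hM : IsMerging SimpleGraph.Dart.symm (faceNext N) (IsTri z N) G comp O t)
    {d : T.Dart} (hd : ¬G (N d)) : comp (N d) = comp d := by
  have faceNext_symm : faceNext N (N d).symm = d := by
    rw [faceNext, SimpleGraph.Dart.symm_symm, Equiv.symm_apply_apply]
  rw [← hM.comp_symm _ hd]
  by_cases htri : IsTri z N (N d).symm
  · rw [← hM.comp_next _ htri, faceNext_symm]
  · have not_tri : ¬IsTri z N d := by
      intro hd
      have faceNext_injective : Function.Injective (faceNext N) :=
        N.symm.injective.comp SimpleGraph.Dart.symm_involutive.injective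
      have symm_eq := faceNext_injective <|
        ((hN.isTriangleMap hT).next_three d hd).trans faceNext_symm.symm
      exact htri (symm_eq ▸ hN.isTri_faceNext hT (hN.isTri_faceNext hT hd))
    rw [hM.comp_outer _ htri, hM.comp_outer _ not_tri]

lemma exists_corner_pow {G : SimpleGraph V} [DecidableRel G.Adj]
    (hT : Maximal (IsPlaneDrawing z) T) (hN : IsRotation z N)
    (hM : IsMerging SimpleGraph.Dart.symm (faceNext N) (IsTri z N)
      (fun d : T.Dart => G.Adj d.fst d.snd) comp O t) {d : T.Dart}
    (hd : G.Adj d.fst d.snd) (i : ℕ) :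
    ∃ g : T.Dart, G.Adj g.fst g.snd ∧ g.fst = ((N ^ i) d).fst ∧ comp g = comp ((N ^ i) d) ∧
      (G.Adj ((N ^ i) d).fst ((N ^ i) d).snd → g = (N ^ i) d) := by
  induction i with
  | zero => exact ⟨d, hd, rfl, rfl, fun _ => rfl⟩
  | succ i ih =>
    rw [pow_succ', Equiv.Perm.mul_apply]
    obtain ⟨g, hg, fst_eq, comp_eq, -⟩ := ih
    by_cases hadj : G.Adj (N ((N ^ i) d)).fst (N ((N ^ i) d)).snd
    · exact ⟨_, hadj, rfl, rfl, fun _ => rfl⟩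
    · exact ⟨g, hg, fst_eq.trans (hN.fst _).symm, comp_eq.trans (hN.comp_apply_eq hT hM hadj).symm,
        fun h => absurd h hadj⟩

lemma exists_isCornerMap {G : SimpleGraph V} [DecidableRel G.Adj]
    (hT : Maximal (IsPlaneDrawing z) T) (hN : IsRotation z N) (hdeg : ∀ v, ∃ w, G.Adj v w)
    (hle : G ≤ T) (hM : IsMerging SimpleGraph.Dart.symm (faceNext N) (IsTri z N)
      (fun d : T.Dart => G.Adj d.fst d.snd) comp O t) :
    ∃ ψ : T.Dart → T.Dart, IsCornerMap (fun d : T.Dart => G.Adj d.fst d.snd) (fun d => d.fst)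
      comp ψ := by
  have exists_corner (d : T.Dart) : ∃ g : T.Dart, G.Adj g.fst g.snd ∧ g.fst = d.fst ∧
      comp g = comp d ∧ (G.Adj d.fst d.snd → g = d) := by
    obtain ⟨w, hw⟩ := hdeg d.fst
    obtain ⟨i, -, pow_eq⟩ := (hN.sameCycle ⟨(d.fst, w), hle hw⟩ d rfl).exists_pow_eq'
    exact pow_eq ▸ hN.exists_corner_pow hT hM hw i
  choose ψ mem src_eq comp_eq self using exists_corner
  exact ⟨ψ, mem, src_eq, comp_eq, self⟩

end IsMerging

end IsRotation

lemma card_darts_eq_degree {V : Type*} [Fintype V] [DecidableEq V] {T G : SimpleGraph V}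
    [DecidableRel G.Adj] [Fintype T.Dart] (hle : G ≤ T) (v : V) :
    (faceDarts (fun d : T.Dart => d.fst) (fun d => G.Adj d.fst d.snd) v).card = G.degree v := by
  rw [← SimpleGraph.card_neighborFinset_eq_degree]
  refine Finset.card_bij (fun d _ => d.snd) (fun d hd => ?_) (fun d hd d' hd' h => ?_)
    fun w hw => ?_
  · obtain ⟨hadj, rfl⟩ := mem_faceDarts.1 hd
    exact (G.mem_neighborFinset _ _).2 hadj
  · exact SimpleGraph.Dart.ext _ _
      (Prod.ext ((mem_faceDarts.1 hd).2.trans (mem_faceDarts.1 hd').2.symm) h)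
  · rw [SimpleGraph.mem_neighborFinset] at hw
    exact ⟨⟨(v, w), hle hw⟩, mem_faceDarts.2 ⟨hw, rfl⟩, rfl⟩

-- `k` is the length of the outer boundary and `s` the number of triangular faces.
lemma IsPlaneDrawing.exists_boundary_counts {V : Type*} [Fintype V] {z : V → ℂ}
    {G : SimpleGraph V} [DecidableRel G.Adj] (hP : IsPlaneDrawing z G)
    (hG : ∀ u v, G.Adj u v → ‖z v - z u‖ = 1) (hdeg : ∀ v, ∃ w, G.Adj v w) :
    ∃ k s : ℕ, k ≤ 4 * (Finset.univ.filter fun v => G.degree v ≤ 4).card ∧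
      ∑ v, G.degree v + k ≤ 4 * Fintype.card V + s ∧
      (s ≠ 0 → s * (√3 / 2) < (k : ℝ) ^ 2 / (2 * Real.pi)) := by
  classical
  obtain ⟨T, hle, hT⟩ := Finite.exists_le_maximal hP
  obtain ⟨N, hN⟩ := hT.prop.exists_isRotation
  have hA := hN.isAngleMap hT hG fun v => by
    obtain ⟨w, hw⟩ := hdeg v
    exact ⟨⟨(v, w), hle hw⟩, rfl⟩
  obtain ⟨C, _, _, comp, O, t, hM⟩ := hA.exists_isMerging
    (G := fun d => G.Adj d.fst d.snd) hA.symm_iff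
  obtain ⟨ψ, hψ⟩ := hN.exists_isCornerMap hT hdeg hle hM
  have card_outer_le := hM.card_outer_le hA hψ
  have card_darts_le := hM.card_darts_le hA
  rw [Finset.card_eq_sum_ones, ← sum_sum_faceDarts (fun d : T.Dart => d.fst)] at card_darts_le
  simp only [← Finset.card_eq_sum_ones, card_darts_eq_degree hle] at card_outer_le card_darts_le
  refine ⟨_, _, card_outer_le, card_darts_le, fun hs => ?_⟩
  refine hM.card_unitTriangles_mul_lt hA (fun d hd => hG _ _ hd) (fun d hd => ?_)
    (fun d hd h₀ h₁ h₂ => ?_) (by positivity) (Finset.card_ne_zero.1 hs)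
  · rw [hN.triSum_areaForm hT hd]
    exact hd.le
  · rw [hN.triSum_areaForm hT hd]
    exact hN.areaForm_dartDir_of_equilateral hT hG hd h₀ h₂ (hA.eq_one_of_equilateral hd h₀ h₁ h₂)

lemma pi_mul_sqrt_three_lt_six : Real.pi * √3 < 6 := by
  have sqrt_three_lt : √3 < 1.8 := by
    rw [Real.sqrt_lt' (by norm_num)]
    norm_num
  nlinarith [Real.pi_lt_d2, Real.sqrt_nonneg 3]

lemma quarter_sqrt_lt_self {n : ℕ} (hn : 0 < n) : 1 / 4 * √(Real.pi * √3 * n) < n := by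
  have one_le : (1 : ℝ) ≤ n := by exact_mod_cast hn
  have sqrt_lt : √(Real.pi * √3 * n) < 4 * n := by
    rw [Real.sqrt_lt' (by positivity)]
    nlinarith [mul_le_mul_of_nonneg_right pi_mul_sqrt_three_lt_six.le n.cast_nonneg]
  linarith

lemma quarter_sqrt_le_self (n : ℕ) : 1 / 4 * √(Real.pi * √3 * n) ≤ n := by
  obtain rfl | hn := n.eq_zero_or_pos
  · simp
  · exact (quarter_sqrt_lt_self hn).le

lemma quarter_sqrt_lt_of_counts {n m k s : ℕ} (hn : 6 ≤ n) (hk : k ≤ 4 * m)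
    (hs : n + k ≤ 4 * m + s) (harea : s ≠ 0 → s * (√3 / 2) < (k : ℝ) ^ 2 / (2 * Real.pi)) :
    1 / 4 * √(Real.pi * √3 * n) < m := by
  have c_lt_six := pi_mul_sqrt_three_lt_six
  set c := Real.pi * √3
  have c_pos : 0 < c := by positivity
  have k_le : (k : ℝ) ≤ 4 * m := by exact_mod_cast hk
  have n_add_k_le : (n : ℝ) + k ≤ 4 * m + s := by exact_mod_cast hs
  by_contra! hm
  set q := √(c * n)
  have q_sq : q ^ 2 = c * n := Real.sq_sqrt (by positivity)
  have q_nonneg : 0 ≤ q := Real.sqrt_nonneg _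
  have q_sq_le : q ^ 2 ≤ c * s + c * (q - k) := by
    rw [q_sq, ← mul_add]
    exact mul_le_mul_of_nonneg_left (by linarith) c_pos.le
  have q_le_c : q ≤ c := by
    obtain rfl | s_ne := eq_or_ne s 0
    · by_contra! c_lt_q
      rw [Nat.cast_zero, mul_zero, zero_add] at q_sq_le
      nlinarith [mul_pos (c_pos.trans c_lt_q) (sub_pos.2 c_lt_q),
        mul_nonneg c_pos.le (k.cast_nonneg (α := ℝ))]
    · have c_mul_s_lt : c * s < (k : ℝ) ^ 2 := by
        have := harea s_ne
        rw [lt_div_iff₀ (by positivity)] at this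
        linarith
      have : (q - k) * (q + k) < (q - k) * c := by linarith
      have := lt_of_mul_lt_mul_left this (by linarith)
      linarith [k.cast_nonneg (α := ℝ)]
  have n_le_c : (n : ℝ) ≤ c := by
    refine le_of_mul_le_mul_left ?_ c_pos
    rw [← q_sq, ← sq]
    exact pow_le_pow_left₀ q_nonneg q_le_c 2
  have six_le : (6 : ℝ) ≤ n := by exact_mod_cast hn
  linarith

lemma IsPlaneDrawing.quarter_sqrt_lt {V : Type*} [Fintype V] [Nonempty V] {z : V → ℂ}
    {G : SimpleGraph V} [DecidableRel G.Adj] (hP : IsPlaneDrawing z G)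
    (hG : ∀ u v, G.Adj u v → ‖z v - z u‖ = 1) (hdeg : ∀ v, ∃ w, G.Adj v w) :
    1 / 4 * √(Real.pi * √3 * Fintype.card V) <
      (Finset.univ.filter fun v => G.degree v ≤ 4).card := by
  obtain hn | hn := Nat.lt_or_ge (Fintype.card V) 6
  · have degree_le (v : V) : G.degree v ≤ 4 := by
      have := G.degree_lt_card_verts v
      omega
    rw [Finset.filter_true_of_mem fun v _ => degree_le v, Finset.card_univ]
    exact quarter_sqrt_lt_self Fintype.card_pos
  · obtain ⟨k, s, k_le, degree_sum_le, area⟩ := hP.exists_boundary_counts hG hdeg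
    refine quarter_sqrt_lt_of_counts hn k_le ?_ area
    have five_le : ∑ v : V, 5 ≤ ∑ v, (G.degree v + if G.degree v ≤ 4 then 4 else 0) := by
      refine Finset.sum_le_sum fun v _ => ?_
      have : 0 < G.degree v := (G.degree_pos_iff_exists_adj v).2 (hdeg v)
      split_ifs <;> omega
    rw [Finset.sum_add_distrib, ← Finset.sum_filter, Finset.sum_const, Finset.sum_const,
      Finset.card_univ, smul_eq_mul, smul_eq_mul] at five_le
    omega

lemma IsMatchstickDrawing.isPlaneDrawing {V : Type*} {G : SimpleGraph V}
    {p : V → EuclideanSpace ℝ (Fin 2)} (hp : IsMatchstickDrawing G p)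
    (e : EuclideanSpace ℝ (Fin 2) ≃ₗᵢ[ℝ] ℂ) :
    IsPlaneDrawing (fun v : G.support => e (p v)) (G.induce G.support) := by
  have mem_segment_iff (a b r) : e r ∈ segment ℝ (e a) (e b) ↔ r ∈ segment ℝ a b := by
    have image_eq := image_segment ℝ e.toLinearEquiv.toLinearMap.toAffineMap a b
    rw [← e.injective.mem_set_image (s := segment ℝ a b)]
    exact Set.ext_iff.1 image_eq.symm (e r)
  refine ⟨fun u v h => Subtype.ext (hp.injective (e.injective h)), fun u v x huv hx => ?_,
    fun u v x y huv hxy hne q hq₁ hq₂ => ?_⟩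
  · by_contra! hne
    rw [mem_segment_iff] at hx
    obtain ⟨y, hy⟩ := x.2
    have edge_ne : s((u : V), (v : V)) ≠ s((x : V), y) := by
      intro h
      have x_mem : (x : V) ∈ s((u : V), (v : V)) := h ▸ Sym2.mem_mk_left _ _
      rw [Sym2.mem_iff, Subtype.coe_inj, Subtype.coe_inj] at x_mem
      exact x_mem.elim hne.1 hne.2
    obtain ⟨w, ⟨hw, -⟩, w_eq⟩ := hp.crossing_free u v x y huv hy edge_ne
      ⟨hx, left_mem_segment ℝ _ _⟩
    rw [hp.injective w_eq, Set.mem_insert_iff, Set.mem_singleton_iff, Subtype.coe_inj,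
      Subtype.coe_inj] at hw
    exact hw.elim hne.1 hne.2
  · obtain ⟨r, rfl⟩ := e.surjective q
    rw [mem_segment_iff] at hq₁ hq₂
    have edge_ne : s((u : V), (v : V)) ≠ s((x : V), (y : V)) := by
      simpa [Sym2.eq_iff, Subtype.ext_iff] using hne
    obtain ⟨w, ⟨rfl | rfl, -⟩, rfl⟩ := hp.crossing_free u v x y huv hxy edge_ne ⟨hq₁, hq₂⟩
    exacts [⟨u, rfl⟩, ⟨v, rfl⟩]

lemma card_filter_degree_le_eq_add {V : Type*} [Fintype V] (G : SimpleGraph V) [DecidableRel G.Adj]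
    [DecidablePred (· ∈ G.support)] (m : ℕ) :
    (Finset.univ.filter fun v => G.degree v ≤ m).card =
      (Finset.univ.filter fun v => (G.induce G.support).degree v ≤ m).card +
        (Finset.univ.filter fun v => v ∉ G.support).card := by
  classical
  have filter_support : ((Finset.univ.filter fun v => G.degree v ≤ m).filter (· ∈ G.support)).card =
      (Finset.univ.filter fun v => (G.induce G.support).degree v ≤ m).card := by
    rw [← Finset.card_subtype]
    congr 1
    ext v
    have degree_eq : (G.induce G.support).degree v = G.degree v := by
      convert SimpleGraph.degree_induce_support v
    rw [Finset.mem_subtype, Finset.mem_filter_univ, Finset.mem_filter_univ, degree_eq]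
  have filter_isolated : (Finset.univ.filter fun v => G.degree v ≤ m).filter (· ∉ G.support) =
      Finset.univ.filter fun v => v ∉ G.support := by
    rw [Finset.filter_filter]
    refine Finset.filter_congr fun v _ => and_iff_right_of_imp fun hv => ?_
    rw [SimpleGraph.mem_support, ← G.degree_pos_iff_exists_adj, not_lt, Nat.le_zero] at hv
    omega
  rw [← Finset.card_filter_add_card_filter_not (· ∈ G.support), filter_support, filter_isolated]

lemma IsMatchstickGraph.quarter_sqrt_lt {V : Type*} [Fintype V] [Nonempty V] {G : SimpleGraph V}
    [DecidableRel G.Adj] (hG : IsMatchstickGraph G) :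
    1 / 4 * √(Real.pi * √3 * Fintype.card V) <
      (Finset.univ.filter fun v => G.degree v ≤ 4).card := by
  classical
  obtain ⟨p, hp⟩ := hG
  set n₀ := (Finset.univ.filter fun v => v ∉ G.support).card with hn₀
  have card_eq : Fintype.card V = Fintype.card G.support + n₀ := by
    rw [← Finset.card_univ, ← Finset.card_filter_add_card_filter_not (· ∈ G.support),
      ← Fintype.card_subtype]
  rw [card_filter_degree_le_eq_add, ← hn₀]
  obtain hempty | hne := isEmpty_or_nonempty G.support
  · rw [Fintype.card_eq_zero (α := G.support), zero_add] at card_eq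
    refine (quarter_sqrt_lt_self Fintype.card_pos).trans_le ?_
    exact_mod_cast card_eq.le.trans (Nat.le_add_left _ _)
  · let e : EuclideanSpace ℝ (Fin 2) ≃ₗᵢ[ℝ] ℂ := Complex.orthonormalBasisOneI.repr.symm
    have unit_length (u v) (huv : (G.induce G.support).Adj u v) : ‖e (p v) - e (p u)‖ = 1 := by
      rw [← dist_eq_norm, e.dist_map, dist_comm]
      exact hp.unit_length u v huv
    have exists_adj (v) : ∃ w, (G.induce G.support).Adj v w := by
      obtain ⟨v, w, hvw⟩ := v
      exact ⟨⟨w, v, hvw.symm⟩, hvw⟩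
    have support_lt := (hp.isPlaneDrawing e).quarter_sqrt_lt unit_length exists_adj
    have isolated_le := quarter_sqrt_le_self n₀
    have sqrt_le : √(Real.pi * √3 * Fintype.card V) ≤
        √(Real.pi * √3 * Fintype.card G.support) + √(Real.pi * √3 * n₀) := by
      rw [card_eq, Nat.cast_add, mul_add]
      refine Real.sqrt_le_iff.2 ⟨by positivity, ?_⟩
      rw [add_sq, Real.sq_sqrt (by positivity), Real.sq_sqrt (by positivity), add_right_comm]
      exact le_add_of_nonneg_right (by positivity)
    push_cast
    linarith

section segment

variable {E : Type*} [NormedAddCommGroup E] [InnerProductSpace ℝ E] {a b c d q : E} {s t : ℝ}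

lemma dist_sq_convex_combination (a b c : E) (hst : s + t = 1) :
    s * dist a c ^ 2 + t * dist b c ^ 2 =
      dist (s • a + t • b) c ^ 2 + s * t * dist a b ^ 2 := by
  obtain rfl : s = 1 - t := eq_sub_of_add_eq hst
  have sub_eq : (1 - t) • a + t • b - c = (1 - t) • (a - c) + t • (b - c) := by module
  rw [dist_eq_norm, dist_eq_norm, dist_eq_norm, dist_eq_norm, sub_eq,
    ← sub_sub_sub_cancel_right a b c, norm_add_sq_real, norm_sub_sq_real (a - c), norm_smul,
    norm_smul, real_inner_smul_left, real_inner_smul_right, mul_pow, mul_pow, Real.norm_eq_abs,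
    Real.norm_eq_abs, sq_abs, sq_abs]
  ring

-- The squared distances between endpoints of crossing unit segments, averaged with the weights
-- of the crossing point, give at most `1 / 2`, so one of these distances is less than `1`.
lemma eq_left_of_mem_segment_of_one_le_dist (hab : dist a b = 1) (hcd : dist c d = 1)
    (had : 1 ≤ dist a d) (hbc : 1 ≤ dist b c) (hbd : 1 ≤ dist b d) (hac : a ≠ c → 1 ≤ dist a c)
    (hq : q ∈ segment ℝ a b) (hq' : q ∈ segment ℝ c d) : a = c ∧ q = a := by
  obtain ⟨s, s', hs, hs', hsum, rfl⟩ := hq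
  obtain ⟨t, t', ht, ht', hsum', heq⟩ := hq'
  have average_c := dist_sq_convex_combination a b c hsum
  have average_d := dist_sq_convex_combination a b d hsum
  have average_q := dist_sq_convex_combination c d (s • a + s' • b) hsum'
  rw [heq, dist_self, dist_comm c, dist_comm d, hcd] at average_q
  rw [hab] at average_c average_d
  have had_sq := mul_le_mul_of_nonneg_left (one_le_pow₀ had (n := 2)) (mul_nonneg hs ht')
  have hbc_sq := mul_le_mul_of_nonneg_left (one_le_pow₀ hbc (n := 2)) (mul_nonneg hs' ht)
  have hbd_sq := mul_le_mul_of_nonneg_left (one_le_pow₀ hbd (n := 2)) (mul_nonneg hs' ht')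
  obtain rfl : s = 1 - s' := eq_sub_of_add_eq hsum
  obtain rfl : t = 1 - t' := eq_sub_of_add_eq hsum'
  have weighted_le : (1 - s') * (1 - t') * (dist a c ^ 2 - 1) + 1 ≤
      s' * (1 - s') + t' * (1 - t') := by nlinarith
  have hac_eq : a = c := by
    by_contra hne
    have hac_sq := mul_nonneg (mul_nonneg hs ht) (sub_nonneg.2 (one_le_pow₀ (hac hne) (n := 2)))
    nlinarith [sq_nonneg (s' - 1 / 2), sq_nonneg (t' - 1 / 2)]
  have s'_eq : s' = 0 := by
    rw [hac_eq, dist_self] at weighted_le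
    nlinarith [sq_nonneg (s' - t'), sq_nonneg t', sq_nonneg s']
  exact ⟨hac_eq, by rw [s'_eq, sub_zero, one_smul, zero_smul, add_zero]⟩

end segment

lemma isMatchstickDrawing_of_one_le_dist {V : Type*} {G : SimpleGraph V}
    {p : V → EuclideanSpace ℝ (Fin 2)} (hp : ∀ u v, u ≠ v → 1 ≤ dist (p u) (p v))
    (hG : ∀ u v, G.Adj u v → dist (p u) (p v) = 1) : IsMatchstickDrawing G p := by
  have injective : Function.Injective p := by
    intro u v h
    by_contra hne
    have := hp u v hne
    rw [h, dist_self] at this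
    linarith
  have common_left (u v x y) (huv : G.Adj u v) (hxy : G.Adj x y) (huy : u ≠ y) (hvx : v ≠ x)
      (hvy : v ≠ y) (q) (hq : q ∈ segment ℝ (p u) (p v)) (hq' : q ∈ segment ℝ (p x) (p y)) :
      u = x ∧ p u = q := by
    obtain ⟨p_eq, rfl⟩ := eq_left_of_mem_segment_of_one_le_dist (hG u v huv) (hG x y hxy)
      (hp u y huy) (hp v x hvx) (hp v y hvy) (fun h => hp u x (ne_of_apply_ne p h)) hq hq'
    exact ⟨injective p_eq, rfl⟩
  refine ⟨injective, hG, ?_⟩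
  rintro u v x y huv hxy hne q ⟨hq, hq'⟩
  by_cases hvy : v = y
  · subst hvy
    have hux : u ≠ x := fun h => hne (h ▸ rfl)
    rw [segment_symm] at hq hq'
    obtain ⟨-, q_eq⟩ := common_left v u v x huv.symm hxy.symm hxy.ne' huv.ne hux q hq hq'
    exact ⟨v, by simp, q_eq⟩
  by_cases huy : u = y
  · subst huy
    have hvx : v ≠ x := fun h => hne (h ▸ Sym2.eq_swap)
    rw [segment_symm ℝ (p x)] at hq'
    obtain ⟨-, q_eq⟩ := common_left u v u x huv hxy.symm hxy.ne' hvy hvx q hq hq'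
    exact ⟨u, by simp, q_eq⟩
  by_cases hvx : v = x
  · subst hvx
    rw [segment_symm] at hq
    obtain ⟨-, q_eq⟩ := common_left v u v y huv.symm hxy hvy huv.ne huy q hq hq'
    exact ⟨v, by simp, q_eq⟩
  obtain ⟨rfl, q_eq⟩ := common_left u v x y huv hxy huy hvx hvy q hq hq'
  exact ⟨u, by simp, q_eq⟩

/-- The point of the triangular lattice in row `i` and column `j`. -/
noncomputable def triangularPoint (i j : ℤ) : EuclideanSpace ℝ (Fin 2) :=
  !₂[j + i / 2, i * (√3 / 2)]

lemma dist_triangularPoint_sq (i j i' j' : ℤ) :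
    dist (triangularPoint i j) (triangularPoint i' j') ^ 2 =
      (((j - j') ^ 2 + (j - j') * (i - i') + (i - i') ^ 2 : ℤ) : ℝ) := by
  have sqrt_three_sq : √3 ^ 2 = 3 := Real.sq_sqrt (by norm_num)
  rw [EuclideanSpace.dist_sq_eq, Fin.sum_univ_two, Real.dist_eq, Real.dist_eq, sq_abs, sq_abs]
  simp only [triangularPoint, PiLp.toLp_apply, Matrix.cons_val_zero, Matrix.cons_val_one]
  push_cast
  linear_combination ((i : ℝ) - i') ^ 2 / 4 * sqrt_three_sq

lemma dist_triangularPoint_eq_one {i j i' j' : ℤ}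
    (h : (j - j') ^ 2 + (j - j') * (i - i') + (i - i') ^ 2 = 1) :
    dist (triangularPoint i j) (triangularPoint i' j') = 1 := by
  rw [← pow_eq_one_iff_of_nonneg dist_nonneg two_ne_zero, dist_triangularPoint_sq, h, Int.cast_one]

lemma one_le_dist_triangularPoint {i j i' j' : ℤ} (h : (i, j) ≠ (i', j')) :
    1 ≤ dist (triangularPoint i j) (triangularPoint i' j') := by
  rw [← one_le_sq_iff₀ dist_nonneg, dist_triangularPoint_sq, ← Int.cast_one, Int.cast_le]
  by_contra! form_lt
  have square_sum : 4 * ((j - j') ^ 2 + (j - j') * (i - i') + (i - i') ^ 2) =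
      (2 * (j - j') + (i - i')) ^ 2 + 3 * (i - i') ^ 2 := by ring
  have same_row : i - i' = 0 := by
    by_contra hi
    linarith [sq_nonneg (2 * (j - j') + (i - i')), Int.add_one_le_of_lt (sq_pos_of_ne_zero hi)]
  rw [same_row, mul_zero, zero_pow two_ne_zero, add_zero, add_zero] at form_lt
  have same_column : j - j' = 0 := (sq_nonpos_iff _).1 (Int.lt_add_one_iff.1 form_lt)
  exact h (Prod.ext (sub_eq_zero.1 same_row) (sub_eq_zero.1 same_column))

/-- The points of the triangular lattice listed row by row, in rows of length `a`. -/
noncomputable def latticePoint (a v : ℕ) : EuclideanSpace ℝ (Fin 2) :=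
  triangularPoint (v / a : ℕ) (v % a : ℕ)

lemma latticePoint_mul_add {a j : ℕ} (i : ℕ) (hj : j < a) :
    latticePoint a (a * i + j) = triangularPoint i j := by
  rw [latticePoint, Nat.mul_add_div (Nat.zero_lt_of_lt hj), Nat.div_eq_of_lt hj, Nat.mul_add_mod,
    Nat.mod_eq_of_lt hj, add_zero]

lemma one_le_dist_latticePoint {a u v : ℕ} (h : u ≠ v) :
    1 ≤ dist (latticePoint a u) (latticePoint a v) := by
  refine one_le_dist_triangularPoint fun heq => h ?_
  rw [Prod.mk.injEq, Nat.cast_inj, Nat.cast_inj] at heq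
  rw [← Nat.div_add_mod u a, ← Nat.div_add_mod v a, heq.1, heq.2]

/-- The unit distance graph of the first `n` lattice points, in rows of length `n.sqrt`. -/
noncomputable def latticeGraph (n : ℕ) : SimpleGraph (Fin n) where
  Adj u v := dist (latticePoint n.sqrt u) (latticePoint n.sqrt v) = 1
  symm := ⟨fun u v h => by rw [dist_comm]; exact h⟩
  loopless := ⟨fun u h => by simp at h⟩

lemma isMatchstickGraph_latticeGraph (n : ℕ) : IsMatchstickGraph (latticeGraph n) :=
  ⟨fun v => latticePoint n.sqrt v, isMatchstickDrawing_of_one_le_dist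
    (fun _ _ h => one_le_dist_latticePoint (Fin.val_ne_of_ne h)) fun _ _ h => h⟩

lemma latticeGraph_adj {n i j i' j' : ℕ} (hj : j < n.sqrt) (hj' : j' < n.sqrt)
    (h : ((j : ℤ) - j') ^ 2 + (j - j') * (i - i') + (i - i') ^ 2 = 1)
    (hv : n.sqrt * i + j < n) (hv' : n.sqrt * i' + j' < n) :
    (latticeGraph n).Adj ⟨n.sqrt * i + j, hv⟩ ⟨n.sqrt * i' + j', hv'⟩ := by
  change dist (latticePoint n.sqrt (n.sqrt * i + j)) (latticePoint n.sqrt (n.sqrt * i' + j')) = 1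
  rw [latticePoint_mul_add i hj, latticePoint_mul_add i' hj']
  exact dist_triangularPoint_eq_one h

lemma four_lt_degree_latticeGraph_mk {n i j : ℕ} [DecidableRel (latticeGraph n).Adj]
    (hj : j + 2 < n.sqrt) (hlast : n.sqrt * (i + 2) + (j + 1) < n)
    (hv : n.sqrt * (i + 1) + (j + 1) < n) :
    4 < (latticeGraph n).degree ⟨n.sqrt * (i + 1) + (j + 1), hv⟩ := by
  have mul_succ : n.sqrt * (i + 1) = n.sqrt * i + n.sqrt := rfl
  have mul_succ_succ : n.sqrt * (i + 2) = n.sqrt * i + n.sqrt + n.sqrt := rfl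
  let s : Finset (Fin n) := {⟨n.sqrt * (i + 1) + j, by omega⟩,
    ⟨n.sqrt * (i + 1) + (j + 2), by omega⟩, ⟨n.sqrt * i + (j + 1), by omega⟩,
    ⟨n.sqrt * (i + 2) + (j + 1), by omega⟩, ⟨n.sqrt * i + (j + 2), by omega⟩}
  have card_eq : s.card = 5 := by
    rw [Finset.card_insert_of_notMem, Finset.card_insert_of_notMem, Finset.card_insert_of_notMem,
      Finset.card_insert_of_notMem, Finset.card_singleton]
    all_goals
      simp only [Finset.mem_insert, Finset.mem_singleton, Fin.mk.injEq]
      omega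
  have subset : s ⊆ (latticeGraph n).neighborFinset ⟨n.sqrt * (i + 1) + (j + 1), hv⟩ := by
    intro w hw
    rw [SimpleGraph.mem_neighborFinset]
    simp only [s, Finset.mem_insert, Finset.mem_singleton] at hw
    rcases hw with rfl | rfl | rfl | rfl | rfl
    all_goals
      refine latticeGraph_adj (by omega) (by omega) ?_ _ _
      push_cast
      ring
  rw [← SimpleGraph.card_neighborFinset_eq_degree]
  exact card_eq.ge.trans (Finset.card_le_card subset)

lemma four_lt_degree_latticeGraph {n : ℕ} [DecidableRel (latticeGraph n).Adj] (v : Fin n)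
    (hfirst : n.sqrt ≤ v) (hlast : v + n.sqrt < n) (hleft : v % n.sqrt ≠ 0)
    (hright : v % n.sqrt ≠ n.sqrt - 1) : 4 < (latticeGraph n).degree v := by
  obtain ⟨v, hv⟩ := v
  have sqrt_pos : 0 < n.sqrt := Nat.sqrt_pos.2 (Nat.zero_lt_of_lt hv)
  have mod_lt := Nat.mod_lt v sqrt_pos
  have div_add_mod := Nat.div_add_mod v n.sqrt
  obtain ⟨i, hi : v / n.sqrt = i + 1⟩ :=
    Nat.exists_eq_succ_of_ne_zero (Nat.div_pos hfirst sqrt_pos).ne'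
  obtain ⟨j, hj : v % n.sqrt = j + 1⟩ := Nat.exists_eq_succ_of_ne_zero hleft
  dsimp only at hright hlast
  rw [hj] at hright mod_lt
  rw [hi, hj] at div_add_mod
  clear hi hj hfirst hleft
  subst div_add_mod
  refine four_lt_degree_latticeGraph_mk (by omega) ?_ hv
  rw [show n.sqrt * (i + 2) = n.sqrt * (i + 1) + n.sqrt from rfl]
  omega

lemma card_filter_le_add_le (n a : ℕ) :
    (Finset.univ.filter fun v : Fin n => n ≤ v + a).card ≤ a := by
  refine le_of_le_of_eq (Finset.card_le_card_of_injOn (t := Finset.range a) (fun v => n - 1 - v)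
    (fun v hv => ?_) fun v _ w _ h => ?_) (Finset.card_range a)
  · rw [Finset.coe_filter_univ, Set.mem_ofPred_eq] at hv
    rw [Finset.mem_coe, Finset.mem_range]
    dsimp only
    omega
  · dsimp only at h
    omega

lemma card_filter_mod_eq_le {n a b : ℕ} (h : n ≤ a * b) (r : ℕ) :
    (Finset.univ.filter fun v : Fin n => v % a = r).card ≤ b := by
  rw [← Finset.card_range b]
  refine Finset.card_le_card_of_injOn (fun v => v / a) (fun v _ => ?_) fun v hv w hw heq => ?_
  · exact Finset.mem_coe.2 (Finset.mem_range.2 (Nat.div_lt_of_lt_mul (v.2.trans_le h)))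
  · rw [Finset.coe_filter_univ, Set.mem_ofPred_eq] at hv hw
    dsimp only at heq
    rw [Fin.ext_iff, ← Nat.div_add_mod v a, ← Nat.div_add_mod w a, hv, hw, heq]

lemma card_degree_le_four_latticeGraph (n : ℕ) [DecidableRel (latticeGraph n).Adj] :
    (Finset.univ.filter fun v => (latticeGraph n).degree v ≤ 4).card ≤ 8 * n.sqrt := by
  obtain rfl | hn := n.eq_zero_or_pos
  · simp
  have sqrt_pos : 0 < n.sqrt := Nat.sqrt_pos.2 hn
  have le_mul : n ≤ n.sqrt * (n.sqrt + 2) := by linarith [Nat.sqrt_le_add n]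
  have subset : (Finset.univ.filter fun v => (latticeGraph n).degree v ≤ 4) ⊆
      ((Finset.univ.filter fun v : Fin n => (v : ℕ) < n.sqrt) ∪
        Finset.univ.filter fun v : Fin n => n ≤ v + n.sqrt) ∪
      ((Finset.univ.filter fun v : Fin n => v % n.sqrt = 0) ∪
        Finset.univ.filter fun v : Fin n => v % n.sqrt = n.sqrt - 1) := by
    intro v hv
    simp only [Finset.mem_filter_univ, Finset.mem_union] at hv ⊢
    by_contra! h
    exact (four_lt_degree_latticeGraph v h.1.1 h.1.2 h.2.1 h.2.2).not_ge hv
  refine (Finset.card_le_card subset).trans <| (Finset.card_union_le _ _).trans <|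
    (add_le_add (Finset.card_union_le _ _) (Finset.card_union_le _ _)).trans ?_
  have first_row := (Fin.card_filter_val_lt (n := n) (m := n.sqrt)).trans_le (min_le_right _ _)
  have last_row := card_filter_le_add_le n n.sqrt
  have left_column := card_filter_mod_eq_le le_mul 0
  have right_column := card_filter_mod_eq_le le_mul (n.sqrt - 1)
  omega

theorem corollary2 :
    (∀ (V : Type*) [Fintype V] [Nonempty V] (G : SimpleGraph V) [DecidableRel G.Adj],
      IsMatchstickGraph G →
        1 / 4 * Real.sqrt (Real.pi * Real.sqrt 3 * (Fintype.card V : ℝ)) <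
          ((Finset.univ.filter fun v : V => G.degree v ≤ 4).card : ℝ)) ∧
    (∃ C : ℝ, 0 < C ∧ ∀ n : ℕ,
      ∃ (G : SimpleGraph (Fin n)) (_ : DecidableRel G.Adj), IsMatchstickGraph G ∧
        ((Finset.univ.filter fun v : Fin n => G.degree v ≤ 4).card : ℝ) ≤
          C * Real.sqrt (n : ℝ)) := by
  classical
  refine ⟨fun V _ _ G _ hG => hG.quarter_sqrt_lt, 8, by norm_num, fun n =>
    ⟨latticeGraph n, inferInstance, isMatchstickGraph_latticeGraph n, ?_⟩⟩
  calc ((Finset.univ.filter fun v : Fin n => (latticeGraph n).degree v ≤ 4).card : ℝ)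
      ≤ 8 * n.sqrt := by exact_mod_cast card_degree_le_four_latticeGraph n
    _ ≤ 8 * √n := by gcongr; exact Real.nat_sqrt_le_real_sqrt
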